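/- Let $N\ge 5$ be odd, let $\epsilon>0$, and put $r_c=\sum_{n=1}^{N}(1/2)^n$. For $r>0$ consider the forced fast/slow system $$\epsilon\,\frac{dx_1}{dt}=x_2+\lambda+x_1(x_1-1),\qquad \frac{dx_2}{dt}=-\sum_{n=1}^{N}x_1^n,\qquad \frac{d\lambda}{dt}=r,$$ with $\lambda=rt$, and the co-moving system, obtained by setting $w=x_2+\lambda$, $$\epsilon\,\frac{dx_1}{dt}=w+x_1(x_1-1),\qquad \frac{dw}{dt}=-\sum_{n=1}^{N}x_1^n+r.$$ Then there is $\delta>0$ (depending on $N$ and $\epsilon$) such that for every $r\in(r_c,r_c+\delta)$ the co-moving system has a nonconstant periodic solution $(x_1^*(t),w^*(t))$ (chosen for each such $r$), with some period $T>0$ and orbit $\Gamma$, having the following properties. 1. $\Gamma$ is a limit cycle: some neighbourhood of $\Gamma$ meets no other periodic orbit. 2. $\Gamma$ is asymptotically stable: solutions of the co-moving system starting close enough to $\Gamma$ exist for all forward time and converge to $\Gamma$, and they stay as close to $\Gamma$ as desired if they start close enough to it. 3. There is an equilibrium $(x_e,w_e)$ of the co-moving system around which $(x_1^*(t),w^*(t))$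 winds exactly once, clockwise, per period $T$; thus the curve $(x_1^*(t),\,w^*(t)-rt,\,rt)$ spirals around the moving point $(x_e,\,w_e-rt,\,rt)$. 4. The spiraling curve $(x_1^*(t),\,w^*(t)-rt,\,rt)$ is a trajectory of the forced system, and trajectories of the forced system follow it: there is $d>0$ such that for all $t_0$ and all initial values $(x_1(t_0),x_2(t_0))$ for which $(x_1(t_0),x_2(t_0)+rt_0)$ lies within distance $d$ of $\Gamma$, the trajectory of the forced system with $\lambda=rt$ exists for all $t\ge t_0$, and for some phase $\theta\in\mathbb{R}$ the distance between $(x_1(t),x_2(t),rt)$ and $(x_1^*(t+\theta),\,w^*(t+\theta)-rt,\,rt)$ tends to $0$ as $t\to\infty$. Moreover, these limit cycles shrink to the point $(x_1,w)=(\tfrac12,\tfrac14)$, the equilibrium of the co-moving system at $r=r_c$, as $r\downarrow r_c$. -/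

import Mathlib

open Set Filter Topology

/-- The critical rate `r_c = ∑_{n=1}^N (1/2)^n`. -/
noncomputable def criticalRate (N : ℕ) : ℝ := ∑ n ∈ Finset.Icc 1 N, (1 / 2 : ℝ) ^ n

/-- The fast/slow system with steady forcing, in the variables `(x₁, x₂, lam)`:
`ε x₁' = x₂ + lam + x₁ (x₁ - 1)`, `x₂' = -∑_{n=1}^N x₁ ^ n`, `lam' = r`. -/
noncomputable def forcedField (N : ℕ) (ε r : ℝ) (q : ℝ × ℝ × ℝ) : ℝ × ℝ × ℝ :=
  ((q.2.1 + q.2.2 + q.1 * (q.1 - 1)) / ε, -∑ n ∈ Finset.Icc 1 N, q.1 ^ n, r)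

/-- The co-moving system in the variables `(x₁, w)`, `w = x₂ + lam`:
`ε x₁' = w + x₁ (x₁ - 1)`, `w' = -∑_{n=1}^N x₁ ^ n + r`. -/
noncomputable def comovingField (N : ℕ) (ε r : ℝ) (p : ℝ × ℝ) : ℝ × ℝ :=
  ((p.2 + p.1 * (p.1 - 1)) / ε, -∑ n ∈ Finset.Icc 1 N, p.1 ^ n + r)

/-- The change of variables `(x₁, x₂, lam) ↦ (x₁, x₂ + lam)`. -/
def toComoving (q : ℝ × ℝ × ℝ) : ℝ × ℝ := (q.1, q.2.1 + q.2.2)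

/-- The curve `t ↦ (x₁(t), w(t) - r t, r t)` belonging to `γ = (x₁, w)`. -/
def spiralCurve (r : ℝ) (γ : ℝ → ℝ × ℝ) (t : ℝ) : ℝ × ℝ × ℝ :=
  ((γ t).1, (γ t).2 - r * t, r * t)

/-- `γ` is a nonconstant periodic solution of `γ' = f(γ)` with period `T > 0`. -/
def IsPeriodicSolution (f : ℝ × ℝ → ℝ × ℝ) (γ : ℝ → ℝ × ℝ) (T : ℝ) : Prop :=
  IsIntegralCurve γ (fun _ => f) ∧ 0 < T ∧ Function.Periodic γ T ∧ ∃ s t, γ s ≠ γ t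

/-- A limit cycle: a periodic solution whose orbit is isolated, i.e. some neighbourhood of the
orbit meets no other periodic orbit. -/
def IsLimitCycle (f : ℝ × ℝ → ℝ × ℝ) (γ : ℝ → ℝ × ℝ) (T : ℝ) : Prop :=
  IsPeriodicSolution f γ T ∧
    ∃ η > 0, ∀ (σ : ℝ → ℝ × ℝ) (S : ℝ), IsPeriodicSolution f σ S →
      (∃ t, Metric.infDist (σ t) (range γ) < η) → range σ = range γ

/-- (Orbital) asymptotic stability of a closed orbit `Γ`: solutions starting near `Γ` exist for all
forward time, stay near `Γ`, and converge to `Γ`. -/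
def IsAsymptoticallyStableOrbit (f : ℝ × ℝ → ℝ × ℝ) (Γ : Set (ℝ × ℝ)) : Prop :=
  (∀ η > 0, ∃ d > 0, ∀ σ : ℝ → ℝ × ℝ, IsIntegralCurveOn σ (fun _ => f) (Ici 0) →
      Metric.infDist (σ 0) Γ < d → ∀ t ≥ 0, Metric.infDist (σ t) Γ < η) ∧
    ∃ d > 0,
      (∀ p, Metric.infDist p Γ < d →
        ∃ σ : ℝ → ℝ × ℝ, σ 0 = p ∧ IsIntegralCurveOn σ (fun _ => f) (Ici 0)) ∧
      ∀ σ : ℝ → ℝ × ℝ, IsIntegralCurveOn σ (fun _ => f) (Ici 0) →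
        Metric.infDist (σ 0) Γ < d →
          Tendsto (fun t => Metric.infDist (σ t) Γ) atTop (𝓝 0)

/-- Over each time interval of length `T`, the curve `γ` winds exactly once, clockwise, around the
point `e` (which it avoids). -/
def WindsOnceClockwise (γ : ℝ → ℝ × ℝ) (T : ℝ) (e : ℝ × ℝ) : Prop :=
  ∃ ρ φ : ℝ → ℝ, Continuous ρ ∧ Continuous φ ∧
    (∀ t, 0 < ρ t ∧ γ t = (e.1 + ρ t * Real.cos (φ t), e.2 + ρ t * Real.sin (φ t))) ∧
    ∀ t, φ (t + T) = φ t - 2 * Real.pi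

/-!
# A stable limit cycle born in a Hopf bifurcation of the co-moving system

At the equilibrium `(x, -x (x - 1))` belonging to the rate `r = ∑ x ^ n` the linearisation of the
co-moving system has trace `(2 x - 1) / ε`, so the equilibrium loses its stability as `x` passes
`1 / 2`, that is, as `r` passes the critical rate. The bifurcation is supercritical because the
second Taylor coefficient of `∑ x ^ n` at `1 / 2` is positive.

The cycle is found without a Poincaré map. After scaling by an amplitude `s`, `s ^ 2 ∼ 2 x - 1`,
the system is written in polar coordinates with the *inverse* radius `y` and the clockwise angle
`θ`, and `y` is regarded as a function of `θ`. The choice of the inverse radius makes the first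
order term of `dy/dθ` independent of `y`, so that it is removed by adding a periodic function of
`θ` to `y`. A second near-identity correction leaves, for an averaged coordinate `M`, the equation
`dM/dθ = -(s ^ 2 κ b / 4) (y - 1 / y) + O(s ^ 3)` (`HopfData.hasDerivAt_M`), with a remainder which
is bounded and Lipschitz in `y` uniformly in all parameters (`UnifLip`). The averaged drift is
strictly decreasing in `y` and vanishes at `y = 1`. Hence for small `s` a neighbourhood of `y = 1`
is forward invariant and any two solutions in it approach each other exponentially
(`HopfData.exists_isContractingODE`).

A periodic scalar equation which contracts in this pointwise sense has a periodic solution,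
obtained as a limit of translates, and attracts all neighbours exponentially
(`IsContractingODE.exists_periodic`, `IsContractingODE.IsSol.exists_attracting`). Time is recovered
from the angle by integration. The times of two solutions, as functions of the angle, differ by a
function with exponentially decaying derivative; its limit is the asymptotic phase
(`IsPolarFlow.exists_phase`). Isolation and stability of the orbit and the tracking of the spiral
curve by the forced system follow from the asymptotic phase and the uniqueness of solutions
(`HasAsymptoticPhase.isLimitCycle`, `HasAsymptoticPhase.isAsymptoticallyStableOrbit`,
`HasAsymptoticPhase.forced_tracking`).
-/

/-! ### Ordinary differential equations -/

/-- A bounded, globally Lipschitz time-dependent vector field has a solution defined for all times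
through every initial point. -/
theorem exists_forall_hasDerivAt_of_lipschitzWith {E : Type*} [NormedAddCommGroup E]
    [NormedSpace ℝ E] [CompleteSpace E] {f : ℝ → E → E} {K L : NNReal}
    (hlip : ∀ t, LipschitzWith K (f t)) (hcont : ∀ x, Continuous fun t => f t x)
    (hbound : ∀ t x, ‖f t x‖ ≤ L) (t₀ : ℝ) (x₀ : E) :
    ∃ α : ℝ → E, α t₀ = x₀ ∧ ∀ t, HasDerivAt α (f t (α t)) t := by
  have key : ∀ n : ℕ, ∃ α : ℝ → E, α t₀ = x₀ ∧
      ∀ t ∈ Ioo (t₀ - (n + 1)) (t₀ + (n + 1)), HasDerivAt α (f t (α t)) t := by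
    intro n
    have hmem : t₀ ∈ Icc (t₀ - (n + 1)) (t₀ + (n + 1)) := ⟨by linarith, by linarith⟩
    have hP : IsPicardLindelof f (⟨t₀, hmem⟩ : Icc (t₀ - (n + 1)) (t₀ + (n + 1 : ℝ))) x₀
        (L * (n + 1)) 0 L K :=
      { lipschitzOnWith := fun t _ => (hlip t).lipschitzOnWith
        continuousOn := fun x _ => (hcont x).continuousOn
        norm_le := fun t _ x _ => hbound t x
        mul_max_le := by simp }
    obtain ⟨α, h0, hα⟩ := hP.exists_eq_forall_mem_Icc_hasDerivWithinAt₀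
    exact ⟨α, h0, fun t ht => (hα t (Ioo_subset_Icc_self ht)).hasDerivAt (Icc_mem_nhds ht.1 ht.2)⟩
  choose α h0 hα using key
  have hagree : ∀ m n : ℕ, m ≤ n →
      EqOn (α m) (α n) (Ioo (t₀ - (m + 1)) (t₀ + (m + 1))) := by
    intro m n hmn
    have hmn' : (m : ℝ) ≤ n := by exact_mod_cast hmn
    refine ODE_solution_unique_of_mem_Ioo (v := f) (s := fun _ => univ) (K := K)
      (fun t _ => (hlip t).lipschitzOnWith) (t₀ := t₀) ⟨by linarith, by linarith⟩
      (fun t ht => ⟨hα m t ht, mem_univ _⟩)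
      (fun t ht => ⟨hα n t ⟨by linarith [ht.1], by linarith [ht.2]⟩, mem_univ _⟩) ?_
    rw [h0, h0]
  refine ⟨fun t => α ⌈|t - t₀|⌉₊ t, by simp [h0], fun t => ?_⟩
  set m := ⌈|t - t₀|⌉₊ + 1 with hm
  have hev : ∀ᶠ s in 𝓝 t, α ⌈|s - t₀|⌉₊ s = α m s := by
    have : ∀ᶠ s in 𝓝 t, |s - t₀| < |t - t₀| + 1 :=
      ContinuousAt.eventually_lt (by fun_prop) (by fun_prop) (by linarith)
    filter_upwards [this] with s hs
    have h1 : |s - t₀| < ⌈|s - t₀|⌉₊ + 1 := by linarith [Nat.le_ceil |s - t₀|]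
    have h2 := abs_lt.1 h1
    refine hagree _ _ ?_ ⟨by linarith, by linarith⟩
    rw [hm, Nat.ceil_le]
    push_cast
    linarith [Nat.le_ceil |t - t₀|]
  have h3 : |t - t₀| < m + 1 := by
    rw [hm]; push_cast; linarith [Nat.le_ceil |t - t₀|]
  have h4 := abs_lt.1 h3
  have h5 := (hα m t ⟨by linarith, by linarith⟩).congr_of_eventuallyEq hev
  have h6 := hev.self_of_nhds
  rwa [← h6] at h5

/-- Forward uniqueness for an autonomous locally Lipschitz vector field. -/
theorem IsIntegralCurveOn.eqOn_Ici {E : Type*} [NormedAddCommGroup E] [NormedSpace ℝ E]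
    {f : E → E} (hf : LocallyLipschitz f) {α β : ℝ → E} {a : ℝ}
    (hα : IsIntegralCurveOn α (fun _ => f) (Ici a))
    (hβ : IsIntegralCurveOn β (fun _ => f) (Ici a)) (h : α a = β a) : EqOn α β (Ici a) := by
  intro t ht
  have hcα : ContinuousOn α (Icc a t) := hα.continuousOn.mono Icc_subset_Ici_self
  have hcβ : ContinuousOn β (Icc a t) := hβ.continuousOn.mono Icc_subset_Ici_self
  have hcomp : IsCompact (α '' Icc a t ∪ β '' Icc a t) :=
    (isCompact_Icc.image_of_continuousOn hcα).union (isCompact_Icc.image_of_continuousOn hcβ)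
  obtain ⟨K, hK⟩ :=
    (hf.locallyLipschitzOn (s := α '' Icc a t ∪ β '' Icc a t)).exists_lipschitzOnWith_of_compact
      hcomp
  refine ODE_solution_unique_of_mem_Icc_right (v := fun _ => f)
    (s := fun _ => α '' Icc a t ∪ β '' Icc a t) (K := K) (fun _ _ => hK) hcα ?_ ?_ hcβ ?_ ?_ h
    ⟨ht, le_rfl⟩
  · exact fun s hs => (hα s hs.1).mono (Ici_subset_Ici.2 hs.1)
  · exact fun s hs => Or.inl (mem_image_of_mem _ (Ico_subset_Icc_self hs))
  · exact fun s hs => (hβ s hs.1).mono (Ici_subset_Ici.2 hs.1)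
  · exact fun s hs => Or.inr (mem_image_of_mem _ (Ico_subset_Icc_self hs))

/-- Time translates of forward integral curves of an autonomous field. -/
theorem IsIntegralCurveOn.comp_add_Ici {E : Type*} [NormedAddCommGroup E] [NormedSpace ℝ E]
    {f : E → E} {α : ℝ → E} {a : ℝ} (hα : IsIntegralCurveOn α (fun _ => f) (Ici a)) (d : ℝ) :
    IsIntegralCurveOn (fun t => α (t + d)) (fun _ => f) (Ici (a - d)) := by
  intro t ht
  have h1 : HasDerivWithinAt (fun t : ℝ => t + d) 1 (Ici (a - d)) t :=
    ((hasDerivAt_id t).add_const d).hasDerivWithinAt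
  have ht' : a - d ≤ t := ht
  have := (hα (t + d) (by simp only [mem_Ici]; linarith)).scomp t h1
    (fun s hs => by simp only [mem_Ici] at hs ⊢; linarith)
  simpa [Function.comp_def] using this

/-! ### Contracting periodic scalar equations -/

/-- A scalar equation `dy/dθ = F θ y`, `2π`-periodic in `θ`, considered on the box `y ∈ [a, b]`.
The function `M θ`, close to the identity in `y`, serves as a `θ`-dependent coordinate; its
derivative along solutions is `G`. Two solutions contract at rate `c` in this coordinate, and the
region `lo ≤ M ≤ hi` lies inside the box and is forward invariant. -/
structure IsContractingODE (F M G : ℝ → ℝ → ℝ) (a b lo hi c : ℝ) : Prop where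
  le : a ≤ b
  lip : ∃ K : NNReal, ∀ θ, LipschitzOnWith K (F θ) (Icc a b)
  cont : ∀ y ∈ Icc a b, Continuous fun θ => F θ y
  bdd : ∃ L : NNReal, ∀ θ, ∀ y ∈ Icc a b, |F θ y| ≤ L
  periodic_field : ∀ θ y, F (θ + 2 * Real.pi) y = F θ y
  periodic_coord : ∀ θ y, M (θ + 2 * Real.pi) y = M θ y
  hasDerivAt_coord : ∀ (y : ℝ → ℝ) (θ : ℝ), y θ ∈ Icc a b → HasDerivAt y (F θ (y θ)) θ →
    HasDerivAt (fun τ => M τ (y τ)) (G θ (y θ)) θ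
  near_id : ∀ θ, ∀ y₁ ∈ Icc a b, ∀ y₂ ∈ Icc a b,
    |(M θ y₁ - M θ y₂) - (y₁ - y₂)| ≤ |y₁ - y₂| / 2
  c_pos : 0 < c
  contract : ∀ θ, ∀ y₁ ∈ Icc a b, ∀ y₂ ∈ Icc a b,
    (M θ y₁ - M θ y₂) * (G θ y₁ - G θ y₂) ≤ -c * (M θ y₁ - M θ y₂) ^ 2
  inside : ∀ θ, ∀ y ∈ Icc a b, M θ y ∈ Icc lo hi → y ∈ Ioo a b
  at_lo : ∀ θ, ∀ y ∈ Icc a b, M θ y = lo → 0 < G θ y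
  at_hi : ∀ θ, ∀ y ∈ Icc a b, M θ y = hi → G θ y < 0
  nonempty : ∃ y ∈ Icc a b, M 0 y ∈ Icc lo hi

/-- A positive continuous periodic function is bounded away from zero. -/
theorem Function.Periodic.exists_pos_le {g : ℝ → ℝ} {T : ℝ} (hper : Function.Periodic g T)
    (hT : 0 < T) (hg : Continuous g) (hpos : ∀ x, 0 < g x) : ∃ m > 0, ∀ x, m ≤ g x := by
  obtain ⟨x, -, hx⟩ := isCompact_Icc.exists_isMinOn (nonempty_Icc.2 hT.le) hg.continuousOn
  refine ⟨g x, hpos x, fun z => ?_⟩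
  obtain ⟨y, hy, hzy⟩ := hper.exists_mem_Ico₀ hT z
  rw [hzy]
  exact hx (Ico_subset_Icc_self hy)

namespace IsContractingODE

variable {F M G : ℝ → ℝ → ℝ} {a b lo hi c : ℝ}

/-- A global solution of the equation whose right hand side is frozen outside the box, so that
global solutions exist. -/
def IsSol (h : IsContractingODE F M G a b lo hi c) (y : ℝ → ℝ) : Prop :=
  ∀ θ, HasDerivAt y (F θ (projIcc a b h.le (y θ))) θ

theorem lipschitzWith_clamp (h : IsContractingODE F M G a b lo hi c) : ∃ K : NNReal, ∀ θ,
    LipschitzWith K fun y => F θ (projIcc a b h.le y) := by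
  obtain ⟨K, hK⟩ := h.lip
  refine ⟨K, fun θ => LipschitzWith.of_dist_le_mul fun y z => ?_⟩
  refine ((hK θ).dist_le_mul _ (projIcc a b h.le y).2 _ (projIcc a b h.le z).2).trans ?_
  have := (LipschitzWith.projIcc h.le).dist_le_mul y z
  gcongr
  rw [NNReal.coe_one, one_mul] at this
  exact this

theorem exists_isSol (h : IsContractingODE F M G a b lo hi c) (θ₀ y₀ : ℝ) : ∃ y, h.IsSol y ∧ y θ₀ = y₀ := by
  obtain ⟨K, hK⟩ := h.lipschitzWith_clamp
  obtain ⟨L, hL⟩ := h.bdd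
  obtain ⟨y, h0, hy⟩ := exists_forall_hasDerivAt_of_lipschitzWith
    (f := fun θ y => F θ (projIcc a b h.le y)) (L := L) hK
    (fun y => h.cont _ (projIcc a b h.le y).2)
    (fun θ y => hL θ _ (projIcc a b h.le y).2) θ₀ y₀
  exact ⟨y, hy, h0⟩

variable {h : IsContractingODE F M G a b lo hi c}

theorem IsSol.continuous {y : ℝ → ℝ} (hy : h.IsSol y) : Continuous y :=
  continuous_iff_continuousAt.2 fun θ => (hy θ).continuousAt

theorem IsSol.hasDerivAt {y : ℝ → ℝ} (hy : h.IsSol y) {θ : ℝ} (hθ : y θ ∈ Icc a b) :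
    HasDerivAt y (F θ (y θ)) θ := by
  have := hy θ
  rwa [projIcc_of_mem h.le hθ] at this

theorem IsSol.hasDerivAt_coord {y : ℝ → ℝ} (hy : h.IsSol y) {θ : ℝ} (hθ : y θ ∈ Icc a b) :
    HasDerivAt (fun τ => M τ (y τ)) (G θ (y θ)) θ :=
  h.hasDerivAt_coord y θ hθ (hy.hasDerivAt hθ)

theorem IsSol.eq {y z : ℝ → ℝ} (hy : h.IsSol y) (hz : h.IsSol z) {θ₀ : ℝ}
    (h0 : y θ₀ = z θ₀) : y = z := by
  obtain ⟨K, hK⟩ := h.lipschitzWith_clamp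
  exact ODE_solution_unique_univ (v := fun θ y => F θ (projIcc a b h.le y)) (s := fun _ => univ)
    (fun θ => (hK θ).lipschitzOnWith) (fun θ => ⟨hy θ, mem_univ _⟩)
    (fun θ => ⟨hz θ, mem_univ _⟩) h0

theorem IsSol.comp_add {y : ℝ → ℝ} (hy : h.IsSol y) : h.IsSol fun θ => y (θ + 2 * Real.pi) := by
  intro θ
  have := (hy (θ + 2 * Real.pi)).comp_add_const θ (2 * Real.pi)
  rwa [h.periodic_field] at this

theorem abs_le_two_mul (h : IsContractingODE F M G a b lo hi c) {θ y₁ y₂ : ℝ} (h₁ : y₁ ∈ Icc a b) (h₂ : y₂ ∈ Icc a b) :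
    |y₁ - y₂| ≤ 2 * |M θ y₁ - M θ y₂| := by
  have h3 := h.near_id θ y₁ h₁ y₂ h₂
  have h4 := abs_sub_abs_le_abs_sub (y₁ - y₂) (M θ y₁ - M θ y₂)
  rw [abs_sub_comm (y₁ - y₂)] at h4
  linarith

theorem abs_coord_le (h : IsContractingODE F M G a b lo hi c) {θ y₁ y₂ : ℝ} (h₁ : y₁ ∈ Icc a b) (h₂ : y₂ ∈ Icc a b) :
    |M θ y₁ - M θ y₂| ≤ 3 / 2 * |y₁ - y₂| := by
  have h3 := h.near_id θ y₁ h₁ y₂ h₂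
  have h4 := abs_sub_abs_le_abs_sub (M θ y₁ - M θ y₂) (y₁ - y₂)
  linarith

/-- The region `lo ≤ M ≤ hi` is forward invariant. -/
theorem IsSol.trap {y : ℝ → ℝ} (hy : h.IsSol y) {θ₀ : ℝ} (h0 : y θ₀ ∈ Icc a b)
    (h0' : M θ₀ (y θ₀) ∈ Icc lo hi) {θ : ℝ} (hθ : θ₀ ≤ θ) :
    y θ ∈ Icc a b ∧ M θ (y θ) ∈ Icc lo hi := by
  set s : Set ℝ := {τ | y τ ∈ Icc a b ∧ M τ (y τ) ∈ Icc lo hi} with hs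
  suffices Icc θ₀ θ ⊆ s from this ⟨hθ, le_rfl⟩
  have hcl : IsClosed s := by
    have h1 : IsClosed (y ⁻¹' Icc a b) := isClosed_Icc.preimage hy.continuous
    have h2 : ContinuousOn (fun τ => M τ (y τ)) (y ⁻¹' Icc a b) := fun τ hτ =>
      (hy.hasDerivAt_coord hτ).continuousAt.continuousWithinAt
    exact h2.preimage_isClosed_of_isClosed h1 isClosed_Icc
  refine (hcl.inter isClosed_Icc).Icc_subset_of_forall_mem_nhdsWithin ⟨h0, h0'⟩ ?_
  rintro τ ⟨⟨hτ, hτ'⟩, -⟩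
  have hd := hy.hasDerivAt_coord hτ
  have hbox : ∀ᶠ σ in 𝓝[>] τ, y σ ∈ Icc a b :=
    nhdsWithin_le_nhds (hy.continuous.continuousAt.eventually_mem
      (mem_of_superset (isOpen_Ioo.mem_nhds (h.inside τ _ hτ hτ')) Ioo_subset_Icc_self))
  have hlo : ∀ᶠ σ in 𝓝[>] τ, lo ≤ M σ (y σ) := by
    rcases hτ'.1.lt_or_eq with h1 | h1
    · exact nhdsWithin_le_nhds ((hd.continuousAt.eventually (lt_mem_nhds h1)).mono
        fun _ => le_of_lt)
    · have hpos := h.at_lo τ _ hτ h1.symm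
      have := (hasDerivWithinAt_iff_tendsto_slope' (by simp)).1 (hd.hasDerivWithinAt (s := Ioi τ))
      filter_upwards [this.eventually (lt_mem_nhds hpos), self_mem_nhdsWithin] with σ hσ hσ'
      rw [slope_def_field, ← h1] at hσ
      have h3 : 0 < σ - τ := sub_pos.2 hσ'
      have := (div_pos_iff_of_pos_right h3).1 hσ
      linarith
  have hhi : ∀ᶠ σ in 𝓝[>] τ, M σ (y σ) ≤ hi := by
    rcases hτ'.2.lt_or_eq with h1 | h1
    · exact nhdsWithin_le_nhds ((hd.continuousAt.eventually (gt_mem_nhds h1)).mono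
        fun _ => le_of_lt)
    · have hneg := h.at_hi τ _ hτ h1
      have := (hasDerivWithinAt_iff_tendsto_slope' (by simp)).1 (hd.hasDerivWithinAt (s := Ioi τ))
      filter_upwards [this.eventually (gt_mem_nhds hneg), self_mem_nhdsWithin] with σ hσ hσ'
      rw [slope_def_field, h1] at hσ
      have h3 : 0 < σ - τ := sub_pos.2 hσ'
      have := (div_neg_iff.1 hσ).resolve_left (fun h => by linarith [h.2])
      linarith [this.1]
  filter_upwards [hbox, hlo, hhi] with σ h1 h2 h3
  exact ⟨h1, h2, h3⟩

/-- Two solutions which stay in the box approach each other exponentially. -/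
theorem IsSol.contraction {y z : ℝ → ℝ} (hy : h.IsSol y) (hz : h.IsSol z) {θ₀ : ℝ}
    (hyb : ∀ θ ≥ θ₀, y θ ∈ Icc a b) (hzb : ∀ θ ≥ θ₀, z θ ∈ Icc a b) {θ : ℝ} (hθ : θ₀ ≤ θ) :
    |y θ - z θ| ≤ 3 * Real.exp (-c * (θ - θ₀)) * |y θ₀ - z θ₀| := by
  set W : ℝ → ℝ := fun τ => M τ (y τ) - M τ (z τ) with hW
  have hWd : ∀ τ ≥ θ₀, HasDerivAt W (G τ (y τ) - G τ (z τ)) τ := fun τ hτ =>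
    (hy.hasDerivAt_coord (hyb τ hτ)).sub (hz.hasDerivAt_coord (hzb τ hτ))
  have hd : ∀ τ ≥ θ₀, HasDerivAt (fun τ => W τ ^ 2 * Real.exp (2 * c * (τ - θ₀)))
      (2 * W τ * (G τ (y τ) - G τ (z τ)) * Real.exp (2 * c * (τ - θ₀)) +
        W τ ^ 2 * (Real.exp (2 * c * (τ - θ₀)) * (2 * c))) τ := by
    intro τ hτ
    have h1 : HasDerivAt (fun τ => 2 * c * (τ - θ₀)) (2 * c) τ := by
      simpa using ((hasDerivAt_id τ).sub_const θ₀).const_mul (2 * c)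
    simpa using ((hWd τ hτ).fun_pow 2).fun_mul h1.exp
  have hanti : AntitoneOn (fun τ => W τ ^ 2 * Real.exp (2 * c * (τ - θ₀))) (Ici θ₀) := by
    refine antitoneOn_of_deriv_nonpos (convex_Ici _)
      (fun τ hτ => (hd τ hτ).continuousAt.continuousWithinAt)
      (fun τ hτ => (hd τ (interior_subset hτ)).differentiableAt.differentiableWithinAt) ?_
    intro τ hτ
    have hτ' := interior_subset hτ
    rw [(hd τ hτ').deriv]
    have h1 := h.contract τ _ (hyb τ hτ') _ (hzb τ hτ')
    have h2 : 2 * W τ * (G τ (y τ) - G τ (z τ)) * Real.exp (2 * c * (τ - θ₀)) +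
        W τ ^ 2 * (Real.exp (2 * c * (τ - θ₀)) * (2 * c)) =
        2 * Real.exp (2 * c * (τ - θ₀)) *
          (W τ * (G τ (y τ) - G τ (z τ)) + c * W τ ^ 2) := by ring
    rw [h2]
    exact mul_nonpos_of_nonneg_of_nonpos (by positivity) (by simp only [hW]; linarith)
  have h1 : W θ ^ 2 * Real.exp (2 * c * (θ - θ₀)) ≤ W θ₀ ^ 2 := by
    simpa using hanti (self_mem_Ici) (mem_Ici.2 hθ) hθ
  have h2 : |W θ| * Real.exp (c * (θ - θ₀)) ≤ |W θ₀| := by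
    refine abs_le_of_sq_le_sq' ?_ (abs_nonneg _) |>.2
    rw [mul_pow, sq_abs, sq_abs, ← Real.exp_nat_mul]
    rwa [show ((2 : ℕ) : ℝ) * (c * (θ - θ₀)) = 2 * c * (θ - θ₀) by push_cast; ring]
  have h3 : |W θ| ≤ Real.exp (-c * (θ - θ₀)) * |W θ₀| := by
    have h4 : Real.exp (-c * (θ - θ₀)) * Real.exp (c * (θ - θ₀)) = 1 := by
      rw [← Real.exp_add]; simp
    calc |W θ| = Real.exp (-c * (θ - θ₀)) * (|W θ| * Real.exp (c * (θ - θ₀))) := by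
          linear_combination (-|W θ|) * h4
      _ ≤ _ := by gcongr
  have h5 := h.abs_le_two_mul (θ := θ) (hyb θ hθ) (hzb θ hθ)
  have h6 := h.abs_coord_le (θ := θ₀) (hyb θ₀ le_rfl) (hzb θ₀ le_rfl)
  calc |y θ - z θ| ≤ 2 * |W θ| := h5
    _ ≤ 2 * (Real.exp (-c * (θ - θ₀)) * |W θ₀|) := by gcongr
    _ ≤ 2 * (Real.exp (-c * (θ - θ₀)) * (3 / 2 * |y θ₀ - z θ₀|)) := by gcongr
    _ = _ := by ring

/-- The equation has a `2π`-periodic solution, whose values stay strictly inside the invariant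
region. It is the limit of the translates `y (· + 2πn)` of any solution in that region. -/
theorem exists_periodic (h : IsContractingODE F M G a b lo hi c) : ∃ y, h.IsSol y ∧ Function.Periodic y (2 * Real.pi) ∧
    ∀ θ, y θ ∈ Ioo a b ∧ M θ (y θ) ∈ Ioo lo hi := by
  obtain ⟨y₀, hy₀, hM₀⟩ := h.nonempty
  obtain ⟨y, hy, rfl⟩ := h.exists_isSol 0 y₀
  have htrap : ∀ θ ≥ 0, y θ ∈ Icc a b ∧ M θ (y θ) ∈ Icc lo hi := fun θ hθ =>
    hy.trap hy₀ hM₀ hθ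
  have hpi := Real.pi_pos
  set u : ℕ → ℝ := fun n => y (n * (2 * Real.pi)) with hu
  have hMper : ∀ (n : ℕ) (v : ℝ), M (n * (2 * Real.pi)) v = M 0 v := by
    intro n v
    have : Function.Periodic (fun θ => M θ v) (2 * Real.pi) := fun θ => h.periodic_coord θ v
    simpa using this.nat_mul n 0
  have hub : ∀ n, u n ∈ Icc a b ∧ M 0 (u n) ∈ Icc lo hi := by
    intro n
    have := htrap (n * (2 * Real.pi)) (by positivity)
    rwa [hMper] at this
  have hcauchy : CauchySeq u := by
    refine cauchySeq_of_le_geometric (Real.exp (-c * (2 * Real.pi)))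
      (3 * |u 0 - u 1|) ?_ ?_
    · rw [Real.exp_lt_one_iff]; nlinarith [h.c_pos]
    · intro n
      have := hy.contraction hy.comp_add (θ₀ := 0) (fun θ hθ => (htrap θ hθ).1)
        (fun θ hθ => (htrap _ (by linarith)).1) (θ := n * (2 * Real.pi)) (by positivity)
      rw [Real.dist_eq, ← Real.exp_nat_mul]
      calc |u n - u (n + 1)|
          = |y (n * (2 * Real.pi)) - y (n * (2 * Real.pi) + 2 * Real.pi)| := by
            simp only [hu]; congr 3; push_cast; ring
        _ ≤ _ := this
        _ = _ := by
          simp only [hu, Nat.cast_zero, zero_mul, zero_add, Nat.cast_one, one_mul, sub_zero]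
          rw [mul_right_comm, show -c * (n * (2 * Real.pi)) = n * (-c * (2 * Real.pi)) by ring]
  obtain ⟨v, hv⟩ := cauchySeq_tendsto_of_complete hcauchy
  have hvb : v ∈ Icc a b := isClosed_Icc.mem_of_tendsto hv (Eventually.of_forall fun n => (hub n).1)
  have hMv : Tendsto (fun n => M 0 (u n)) atTop (𝓝 (M 0 v)) := by
    rw [tendsto_iff_dist_tendsto_zero] at hv ⊢
    refine squeeze_zero (fun _ => dist_nonneg) (fun n => ?_) (by simpa using hv.const_mul (3 / 2))
    exact h.abs_coord_le (hub n).1 hvb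
  have hvM : M 0 v ∈ Icc lo hi :=
    isClosed_Icc.mem_of_tendsto hMv (Eventually.of_forall fun n => (hub n).2)
  obtain ⟨z, hz, rfl⟩ := h.exists_isSol 0 v
  have hztrap : ∀ θ ≥ 0, z θ ∈ Icc a b ∧ M θ (z θ) ∈ Icc lo hi := fun θ hθ =>
    hz.trap hvb hvM hθ
  have hz2 : z (2 * Real.pi) = z 0 := by
    refine tendsto_nhds_unique (f := fun n => u (n + 1)) (l := atTop) ?_
      ((tendsto_add_atTop_iff_nat 1).2 hv)
    rw [tendsto_iff_dist_tendsto_zero] at hv ⊢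
    refine squeeze_zero (fun _ => dist_nonneg) (fun n => ?_)
      (by simpa using hv.const_mul (3 * Real.exp (-c * (2 * Real.pi - 0))))
    -- the translate of `y` by `2πn` is a solution, and it is compared with `z` after one period
    have hsol : ∀ k : ℕ, h.IsSol fun θ => y (θ + k * (2 * Real.pi)) := by
      intro k
      induction k with
      | zero => simpa using hy
      | succ k ih =>
        convert ih.comp_add using 3 with θ
        push_cast; ring
    have := (hsol n).contraction hz (θ₀ := 0)
      (fun θ hθ => (htrap _ (add_nonneg hθ (by positivity))).1)
      (fun θ hθ => (hztrap θ hθ).1) (θ := 2 * Real.pi) (by positivity)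
    rw [Real.dist_eq, Real.dist_eq]
    have e1 : u (n + 1) = y (2 * Real.pi + n * (2 * Real.pi)) := by
      simp only [hu]; congr 1; push_cast; ring
    have e2 : u n = y (0 + n * (2 * Real.pi)) := by rw [zero_add]
    rw [e1, e2]
    rwa [sub_zero, neg_mul] at this
  have hper : Function.Periodic z (2 * Real.pi) := by
    have := hz.comp_add.eq hz (θ₀ := 0) (by simpa using hz2)
    exact fun θ => congrFun this θ
  have hall : ∀ θ, z θ ∈ Icc a b ∧ M θ (z θ) ∈ Icc lo hi := by
    intro θ
    obtain ⟨n, hn⟩ := exists_nat_gt (-θ / (2 * Real.pi))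
    have h1 : 0 ≤ θ + n * (2 * Real.pi) := by
      rw [div_lt_iff₀ (by positivity)] at hn; linarith
    have h2 := hztrap _ h1
    have h3 : z (θ + n * (2 * Real.pi)) = z θ := hper.nat_mul n θ
    have h4 : Function.Periodic (fun τ => M τ (z θ)) (2 * Real.pi) :=
      fun τ => h.periodic_coord τ _
    have h5 : M (θ + n * (2 * Real.pi)) (z θ) = M θ (z θ) := h4.nat_mul n θ
    rwa [h3, h5] at h2
  refine ⟨z, hz, hper, fun θ => ⟨h.inside θ _ (hall θ).1 (hall θ).2, ?_, ?_⟩⟩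
  · -- at a time where `M = lo` the coordinate would have a minimum with positive derivative
    refine (hall θ).2.1.lt_of_ne fun heq => ?_
    have hmin : IsLocalMin (fun τ => M τ (z τ)) θ :=
      Eventually.of_forall fun τ => by
        change M θ (z θ) ≤ M τ (z τ)
        rw [← heq]; exact (hall τ).2.1
    have := hmin.hasDerivAt_eq_zero (hz.hasDerivAt_coord (hall θ).1)
    exact absurd this (h.at_lo θ _ (hall θ).1 heq.symm).ne'
  · refine (hall θ).2.2.lt_of_ne fun heq => ?_
    have hmax : IsLocalMax (fun τ => M τ (z τ)) θ :=
      Eventually.of_forall fun τ => by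
        change M τ (z τ) ≤ M θ (z θ)
        rw [heq]; exact (hall τ).2.2
    have := hmax.hasDerivAt_eq_zero (hz.hasDerivAt_coord (hall θ).1)
    exact absurd this (h.at_hi θ _ (hall θ).1 heq).ne

/-- Solutions starting close to the periodic one stay in the box and converge to it. -/
theorem IsSol.exists_attracting {z : ℝ → ℝ} (hz : h.IsSol z)
    (hper : Function.Periodic z (2 * Real.pi))
    (hin : ∀ θ, z θ ∈ Ioo a b ∧ M θ (z θ) ∈ Ioo lo hi) :
    ∃ d > 0, ∀ (y : ℝ → ℝ) (θ₀ : ℝ), h.IsSol y → |y θ₀ - z θ₀| < d →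
      (∀ θ ≥ θ₀, y θ ∈ Icc a b) ∧
      ∀ θ ≥ θ₀, |y θ - z θ| ≤ 3 * Real.exp (-c * (θ - θ₀)) * |y θ₀ - z θ₀| := by
  have hMc : Continuous fun θ => M θ (z θ) := continuous_iff_continuousAt.2 fun θ =>
    (hz.hasDerivAt_coord (Ioo_subset_Icc_self (hin θ).1)).continuousAt
  have hzc := hz.continuous
  set g : ℝ → ℝ := fun θ =>
    min (min (z θ - a) (b - z θ)) (min (M θ (z θ) - lo) (hi - M θ (z θ))) with hg
  have hgper : Function.Periodic g (2 * Real.pi) := by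
    intro θ
    simp only [hg, hper θ, h.periodic_coord]
  obtain ⟨m, hm, hmg⟩ := hgper.exists_pos_le (by positivity) 
    (((hzc.sub continuous_const).min (continuous_const.sub hzc)).min
      ((hMc.sub continuous_const).min (continuous_const.sub hMc))) (fun θ => by
    obtain ⟨⟨h1, h2⟩, h3, h4⟩ := hin θ
    simp only [hg, lt_min_iff, sub_pos]
    exact ⟨⟨h1, h2⟩, h3, h4⟩)
  refine ⟨m / 2, by positivity, fun y θ₀ hy hd => ?_⟩
  have hmg' := hmg θ₀
  simp only [hg, le_min_iff] at hmg'
  obtain ⟨⟨h1, h2⟩, h3, h4⟩ := hmg'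
  have hd' := abs_lt.1 hd
  have hyb : y θ₀ ∈ Icc a b := ⟨by linarith, by linarith⟩
  have hM := abs_le.1 ((h.abs_coord_le (θ := θ₀) hyb (Ioo_subset_Icc_self (hin θ₀).1)).trans
    (mul_le_mul_of_nonneg_left hd.le (by norm_num)))
  have hbox : ∀ θ ≥ θ₀, y θ ∈ Icc a b := fun θ hθ =>
    (hy.trap hyb ⟨by linarith, by linarith⟩ hθ).1
  exact ⟨hbox, fun θ hθ => hy.contraction hz hbox
    (fun τ _ => Ioo_subset_Icc_self (hin τ).1) hθ⟩

end IsContractingODE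

/-! ### Change of time and polar coordinates -/

/-- A quantity whose derivative decays exponentially has a limit. -/
theorem exists_tendsto_of_abs_deriv_le_exp {D D' : ℝ → ℝ} {θ₀ C c : ℝ} (hc : 0 < c)
    (hD : ∀ θ, HasDerivAt D (D' θ) θ) (hcont : Continuous D')
    (hbound : ∀ θ ≥ θ₀, |D' θ| ≤ C * Real.exp (-c * (θ - θ₀))) :
    ∃ l, Tendsto D atTop (𝓝 l) := by
  refine ⟨_, MeasureTheory.tendsto_limUnder_of_hasDerivAt_of_integrableOn_Ioi (a := θ₀)
    (fun θ _ => hD θ) ?_⟩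
  have h1 : MeasureTheory.IntegrableOn (fun θ => C * Real.exp (c * θ₀) * Real.exp (-c * θ))
      (Ioi θ₀) := (integrableOn_exp_mul_Ioi (neg_neg_of_pos hc) θ₀).const_mul _
  refine h1.mono' hcont.aestronglyMeasurable.restrict ?_
  refine (MeasureTheory.ae_restrict_iff' measurableSet_Ioi).2 (Eventually.of_forall fun θ hθ => ?_)
  refine (hbound θ (le_of_lt hθ)).trans_eq ?_
  rw [mul_assoc, ← Real.exp_add]
  ring_nf

/-- `τ` is a new time with `dτ/dθ = q(θ)`, and `ϑ` is its inverse. -/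
structure IsTimeChange (q τ ϑ : ℝ → ℝ) : Prop where
  hasDerivAt_time : ∀ θ, HasDerivAt τ (q θ) θ
  time_angle : ∀ t, τ (ϑ t) = t
  angle_time : ∀ θ, ϑ (τ θ) = θ
  hasDerivAt_angle : ∀ t, HasDerivAt ϑ (q (ϑ t))⁻¹ t
  strictMono : StrictMono ϑ
  tendsto_angle : Tendsto ϑ atTop atTop

theorem exists_isTimeChange {q : ℝ → ℝ} (hq : Continuous q) {m : ℝ} (hm : 0 < m)
    (hmq : ∀ θ, m ≤ q θ) (θ₀ : ℝ) : ∃ τ ϑ : ℝ → ℝ, τ θ₀ = 0 ∧ IsTimeChange q τ ϑ := by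
  set τ : ℝ → ℝ := fun θ => ∫ x in θ₀..θ, q x with hτ
  have hd : ∀ θ, HasDerivAt τ (q θ) θ := fun θ =>
    intervalIntegral.integral_hasDerivAt_right (hq.intervalIntegrable _ _)
      (hq.stronglyMeasurableAtFilter _ _) hq.continuousAt
  have hpos : ∀ θ, 0 < q θ := fun θ => hm.trans_le (hmq θ)
  have hmono : StrictMono τ := strictMono_of_hasDerivAt_pos hd hpos
  have hτ0 : τ θ₀ = 0 := by simp [hτ]
  have hcont : Continuous τ := continuous_iff_continuousAt.2 fun θ => (hd θ).continuousAt
  have hmv : ∀ ⦃x y⦄, x ≤ y → m * (y - x) ≤ τ y - τ x :=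
    mul_sub_le_image_sub_of_le_deriv (fun θ => (hd θ).differentiableAt)
      (fun θ => by rw [(hd θ).deriv]; exact hmq θ)
  have hlin : Tendsto (fun θ => m * (θ - θ₀)) atTop atTop :=
    (tendsto_atTop_add_const_right _ (-θ₀) tendsto_id).const_mul_atTop hm
  have hlin' : Tendsto (fun θ => m * (θ - θ₀)) atBot atBot :=
    (tendsto_atBot_add_const_right _ (-θ₀) tendsto_id).const_mul_atBot hm
  have htop : Tendsto τ atTop atTop := by
    refine tendsto_atTop_mono' _ ?_ hlin
    filter_upwards [eventually_ge_atTop θ₀] with θ hθ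
    linarith [hmv hθ]
  have hbot : Tendsto τ atBot atBot := by
    refine tendsto_atBot_mono' _ ?_ hlin'
    filter_upwards [eventually_le_atBot θ₀] with θ hθ
    linarith [hmv hθ]
  set e : ℝ ≃o ℝ := hmono.orderIsoOfSurjective τ (hcont.surjective htop hbot) with he
  have heτ : ∀ θ, e θ = τ θ := fun θ => rfl
  refine ⟨τ, e.symm, hτ0, hd, fun t => by rw [← heτ, e.apply_symm_apply],
    fun θ => by rw [← heτ, e.symm_apply_apply], fun t => ?_, e.symm.strictMono,
    e.symm.tendsto_atTop⟩
  exact HasDerivAt.of_local_left_inverse e.symm.continuous.continuousAt (hd _) (hpos _).ne'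
    (Eventually.of_forall fun s => by rw [← heτ, e.apply_symm_apply])

/-- The polar angle of the ellipse `θ ↦ (A cos θ, B sin θ)` lifts to a continuous function which
increases by `2π` when `θ` does. -/
theorem exists_ellipse_angle {A B : ℝ} (hA : 0 < A) (hB : 0 < B) :
    ∃ R ψ : ℝ → ℝ, Continuous R ∧ Continuous ψ ∧ (∀ θ, 0 < R θ) ∧
      (∀ θ, A * Real.cos θ = R θ * Real.cos (ψ θ)) ∧
      (∀ θ, B * Real.sin θ = R θ * Real.sin (ψ θ)) ∧
      ∀ θ, ψ (θ + 2 * Real.pi) = ψ θ + 2 * Real.pi := by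
  -- `z θ` is the point of the ellipse rotated by `-θ`; it stays in the right half plane
  set z : ℝ → ℂ := fun θ => ⟨A * Real.cos θ ^ 2 + B * Real.sin θ ^ 2,
    (B - A) * Real.sin θ * Real.cos θ⟩ with hz
  have hre : ∀ θ, 0 < (z θ).re := by
    intro θ
    have h1 := Real.sin_sq_add_cos_sq θ
    have h2 : 0 ≤ A * Real.cos θ ^ 2 := by positivity
    have h3 : 0 ≤ B * Real.sin θ ^ 2 := by positivity
    simp only [hz]
    rcases (sq_nonneg (Real.sin θ)).eq_or_lt with h | h
    · have : Real.cos θ ^ 2 = 1 := by linarith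
      rw [this]; linarith
    · have := mul_pos hB h
      linarith
  have hzc : Continuous z := by
    have : z = fun θ => ((A * Real.cos θ ^ 2 + B * Real.sin θ ^ 2 : ℝ) : ℂ) +
        (((B - A) * Real.sin θ * Real.cos θ : ℝ) : ℂ) * Complex.I := by
      funext θ; exact Complex.mk_eq_add_mul_I _ _
    rw [this]
    fun_prop
  have hne : ∀ θ, z θ ≠ 0 := fun θ h => by simpa [h] using hre θ
  have hcos : ∀ θ, ‖z θ‖ * Real.cos (z θ).arg = (z θ).re := fun θ => Complex.norm_mul_cos_arg _
  have hsin : ∀ θ, ‖z θ‖ * Real.sin (z θ).arg = (z θ).im := fun θ => Complex.norm_mul_sin_arg _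
  refine ⟨fun θ => ‖z θ‖, fun θ => θ + (z θ).arg, by fun_prop, ?_, fun θ => norm_pos_iff.2 (hne θ),
    fun θ => ?_, fun θ => ?_, fun θ => ?_⟩
  · refine continuous_id.add (continuous_iff_continuousAt.2 fun θ => ?_)
    exact (Complex.continuousAt_arg (Or.inl (hre θ))).comp hzc.continuousAt
  · have h1 := hcos θ
    have h2 := hsin θ
    have h3 := Real.sin_sq_add_cos_sq θ
    simp only [hz] at h1 h2 ⊢
    rw [Real.cos_add]
    linear_combination (-Real.cos θ) * h1 + Real.sin θ * h2 - A * Real.cos θ * h3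
  · have h1 := hcos θ
    have h2 := hsin θ
    have h3 := Real.sin_sq_add_cos_sq θ
    simp only [hz] at h1 h2 ⊢
    rw [Real.sin_add]
    linear_combination (-Real.sin θ) * h1 - Real.cos θ * h2 - B * Real.sin θ * h3
  · simp only [hz, Real.cos_add_two_pi, Real.sin_add_two_pi]
    ring

/-- The point with clockwise elliptic polar angle `θ` and inverse radius `y` around `e`. -/
noncomputable def polarPoint (e : ℝ × ℝ) (A B θ y : ℝ) : ℝ × ℝ :=
  (e.1 + A * Real.cos θ / y, e.2 - B * Real.sin θ / y)

/-- The inverse of `polarPoint`, as a complex number. -/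
noncomputable def polarInv (e : ℝ × ℝ) (A B : ℝ) (p : ℝ × ℝ) : ℂ :=
  (((p.1 - e.1) / A : ℝ) : ℂ) + (((e.2 - p.2) / B : ℝ) : ℂ) * Complex.I

theorem polarPoint_add_two_pi (e : ℝ × ℝ) (A B θ y : ℝ) :
    polarPoint e A B (θ + 2 * Real.pi) y = polarPoint e A B θ y := by
  simp [polarPoint]

theorem dist_polarPoint_le (e : ℝ × ℝ) {A B a : ℝ} (hA : 0 < A) (hB : 0 < B) (ha : 0 < a)
    {θ₁ θ₂ y₁ y₂ : ℝ} (h₁ : a ≤ y₁) (h₂ : a ≤ y₂) :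
    dist (polarPoint e A B θ₁ y₁) (polarPoint e A B θ₂ y₂) ≤
      max A B * (1 / a * |θ₁ - θ₂| + 1 / a ^ 2 * |y₁ - y₂|) := by
  have hy₁ : 0 < y₁ := ha.trans_le h₁
  have hy₂ : 0 < y₂ := ha.trans_le h₂
  have key : ∀ c₁ c₂ : ℝ, |c₁ - c₂| ≤ |θ₁ - θ₂| → |c₂| ≤ 1 →
      |c₁ / y₁ - c₂ / y₂| ≤ 1 / a * |θ₁ - θ₂| + 1 / a ^ 2 * |y₁ - y₂| := by
    intro c₁ c₂ h3 h4
    have h5 : c₁ / y₁ - c₂ / y₂ = 1 / y₁ * (c₁ - c₂) + c₂ * (1 / (y₁ * y₂)) * (y₂ - y₁) := by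
      field_simp; ring
    have h6 : 1 / y₁ ≤ 1 / a := one_div_le_one_div_of_le ha h₁
    have h7 : 1 / (y₁ * y₂) ≤ 1 / a ^ 2 :=
      one_div_le_one_div_of_le (by positivity) (by nlinarith)
    rw [h5]
    refine (abs_add_le _ _).trans (add_le_add ?_ ?_)
    · rw [abs_mul, abs_of_pos (by positivity : 0 < 1 / y₁)]
      gcongr
    · rw [abs_mul, abs_mul, abs_of_pos (by positivity : 0 < 1 / (y₁ * y₂)), abs_sub_comm y₂]
      calc |c₂| * (1 / (y₁ * y₂)) * |y₁ - y₂| ≤ 1 * (1 / a ^ 2) * |y₁ - y₂| := by gcongr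
        _ = _ := by ring
  have hc := key _ _ (Real.abs_cos_sub_cos_le θ₁ θ₂) (Real.abs_cos_le_one θ₂)
  have hs := key _ _ (Real.abs_sin_sub_sin_le θ₁ θ₂) (Real.abs_sin_le_one θ₂)
  rw [Prod.dist_eq]
  refine max_le ?_ ?_
  · rw [Real.dist_eq]
    have : (polarPoint e A B θ₁ y₁).1 - (polarPoint e A B θ₂ y₂).1 =
        A * (Real.cos θ₁ / y₁ - Real.cos θ₂ / y₂) := by simp only [polarPoint]; ring
    rw [this, abs_mul, abs_of_pos hA]
    exact mul_le_mul (le_max_left _ _) hc (abs_nonneg _) (by positivity)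
  · rw [Real.dist_eq]
    have : (polarPoint e A B θ₁ y₁).2 - (polarPoint e A B θ₂ y₂).2 =
        -(B * (Real.sin θ₁ / y₁ - Real.sin θ₂ / y₂)) := by simp only [polarPoint]; ring
    rw [this, abs_neg, abs_mul, abs_of_pos hB]
    exact mul_le_mul (le_max_right _ _) hs (abs_nonneg _) (by positivity)

theorem polarInv_polarPoint (e : ℝ × ℝ) {A B : ℝ} (hA : 0 < A) (hB : 0 < B) (θ y : ℝ) :
    polarInv e A B (polarPoint e A B θ y) =
      ((y⁻¹ : ℝ) : ℂ) * (Real.Angle.cos θ + Real.Angle.sin θ * Complex.I) := by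
  have h1 : (e.1 + A * Real.cos θ / y - e.1) / A = y⁻¹ * Real.cos θ := by
    field_simp; ring
  have h2 : (e.2 - (e.2 - B * Real.sin θ / y)) / B = y⁻¹ * Real.sin θ := by
    field_simp; ring
  simp only [polarInv, polarPoint, h1, h2, Real.Angle.cos_coe, Real.Angle.sin_coe]
  push_cast; ring

theorem polarPoint_polarInv (e : ℝ × ℝ) {A B : ℝ} (hA : 0 < A) (hB : 0 < B) (p : ℝ × ℝ) :
    polarPoint e A B (polarInv e A B p).arg (‖polarInv e A B p‖⁻¹) = p := by
  have h1 : ‖polarInv e A B p‖ * Real.cos (polarInv e A B p).arg = (p.1 - e.1) / A := by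
    rw [Complex.norm_mul_cos_arg]; simp [polarInv]
  have h2 : ‖polarInv e A B p‖ * Real.sin (polarInv e A B p).arg = (e.2 - p.2) / B := by
    rw [Complex.norm_mul_sin_arg]; simp [polarInv]
  simp only [polarPoint, div_inv_eq_mul]
  rw [mul_assoc, mul_comm (Real.cos _), h1, mul_assoc, mul_comm (Real.sin _), h2]
  ext
  · simp only; field_simp; ring
  · simp only; field_simp; ring

/-- Points near a closed curve `θ ↦ polarPoint θ (z θ)` have polar coordinates `(θ, y)` with `y`
near `z θ`. -/
theorem exists_polar_of_infDist_lt (e : ℝ × ℝ) {A B : ℝ} (hA : 0 < A) (hB : 0 < B) {z : ℝ → ℝ}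
    (hz : Continuous z) (hper : Function.Periodic z (2 * Real.pi)) (hpos : ∀ θ, 0 < z θ)
    {η : ℝ} (hη : 0 < η) :
    ∃ d > 0, ∀ p, Metric.infDist p (range fun θ => polarPoint e A B θ (z θ)) < d →
      ∃ θ y, p = polarPoint e A B θ y ∧ |y - z θ| < η := by
  set Γ := range fun θ => polarPoint e A B θ (z θ) with hΓ
  have hΓc : IsCompact Γ := by
    refine Function.Periodic.compact_of_continuous (c := 2 * Real.pi) ?_ (by positivity) ?_
    · intro θ
      simp only [hper θ, polarPoint_add_two_pi]
    · simp only [polarPoint]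
      have := fun θ => (hpos θ).ne'
      fun_prop (disch := assumption)
  set zl : Real.Angle → ℝ := hper.lift with hzl
  have hzlc : Continuous zl := continuous_quot_lift _ hz
  have hzlθ : ∀ θ : ℝ, zl θ = z θ := fun θ => hper.lift_coe θ
  have hinv : Continuous (polarInv e A B) := by unfold polarInv; fun_prop
  set g : ℝ × ℝ → ℝ := fun p => ‖polarInv e A B p‖⁻¹ - zl (polarInv e A B p).arg with hg
  set U : Set (ℝ × ℝ) := {p | polarInv e A B p ≠ 0 ∧ |g p| < η} with hU
  have hgc : ∀ p, polarInv e A B p ≠ 0 → ContinuousAt g p := by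
    intro p hp
    refine ContinuousAt.sub ?_ ?_
    · exact (hinv.norm.continuousAt).inv₀ (norm_ne_zero_iff.2 hp)
    · exact hzlc.continuousAt.comp
        ((Complex.continuousAt_arg_coe_angle hp).comp hinv.continuousAt)
  have hUo : IsOpen U := by
    rw [isOpen_iff_mem_nhds]
    rintro p ⟨hp, hpη⟩
    filter_upwards [hinv.continuousAt.eventually_ne hp,
      (hgc p hp).abs.eventually (gt_mem_nhds hpη)] with w h1 h2
    exact ⟨h1, h2⟩
  have hΓU : Γ ⊆ U := by
    rintro _ ⟨θ, rfl⟩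
    have h1 := polarInv_polarPoint e hA hB θ (z θ)
    have h2 : 0 < (z θ)⁻¹ := inv_pos.2 (hpos θ)
    have h3 : ((polarInv e A B (polarPoint e A B θ (z θ))).arg : Real.Angle) = θ := by
      rw [h1, Complex.arg_mul_cos_add_sin_mul_I_coe_angle h2]
    have h4 : ‖polarInv e A B (polarPoint e A B θ (z θ))‖ = (z θ)⁻¹ := by
      rw [h1, norm_mul, Complex.norm_real, Real.norm_of_nonneg h2.le, Real.Angle.cos_coe,
        Real.Angle.sin_coe, Complex.ofReal_cos, Complex.ofReal_sin,
        Complex.norm_cos_add_sin_mul_I, mul_one]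
    refine ⟨fun h0 => ?_, ?_⟩
    · rw [h0, norm_zero] at h4
      exact h2.ne h4
    · change |‖_‖⁻¹ - zl _| < η
      rw [h3, h4, hzlθ, inv_inv, sub_self, abs_zero]
      exact hη
  obtain ⟨d, hd, hsub⟩ := hΓc.exists_thickening_subset_open hUo hΓU
  refine ⟨d, hd, fun p hp => ?_⟩
  have hpU : p ∈ U := hsub ((Metric.mem_thickening_iff_infDist_lt (range_nonempty _)).2 hp)
  refine ⟨(polarInv e A B p).arg, ‖polarInv e A B p‖⁻¹, (polarPoint_polarInv e hA hB p).symm, ?_⟩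
  have := hpU.2
  simpa only [hg, hzlθ] using this

/-! ### Planar systems in polar form -/

/-- The planar vector field `f`, written in the coordinates `polarPoint e A B θ y`, becomes
`dθ/dt = 1 / p θ y`, `dy/dθ = F θ y` for `y ∈ [a, b]`, and the equation for `y` is contracting. -/
structure IsPolarFlow (F p M G : ℝ → ℝ → ℝ) (a b lo hi c : ℝ) (e : ℝ × ℝ) (A B : ℝ)
    (f : ℝ × ℝ → ℝ × ℝ) : Prop extends IsContractingODE F M G a b lo hi c where
  a_pos : 0 < a
  A_pos : 0 < A
  B_pos : 0 < B
  slowness_cont : ContinuousOn (Function.uncurry p) (univ ×ˢ Icc a b)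
  slowness_pos : ∃ m > 0, ∀ θ, ∀ y ∈ Icc a b, m ≤ p θ y
  slowness_periodic : ∀ θ y, p (θ + 2 * Real.pi) y = p θ y
  slowness_lip : ∃ K : NNReal, ∀ θ, LipschitzOnWith K (p θ) (Icc a b)
  field : ∀ (ϑ y : ℝ → ℝ) (t : ℝ), y t ∈ Icc a b → HasDerivAt ϑ (p (ϑ t) (y t))⁻¹ t →
    HasDerivAt y (F (ϑ t) (y t) * (p (ϑ t) (y t))⁻¹) t →
    HasDerivAt (fun s => polarPoint e A B (ϑ s) (y s)) (f (polarPoint e A B (ϑ t) (y t))) t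

namespace IsPolarFlow

variable {F p M G : ℝ → ℝ → ℝ} {a b lo hi c : ℝ} {e : ℝ × ℝ} {A B : ℝ} {f : ℝ × ℝ → ℝ × ℝ}

/-- The derivative `dt/dθ` of time along a solution `y`. -/
noncomputable def slowness (h : IsPolarFlow F p M G a b lo hi c e A B f) (y : ℝ → ℝ) (θ : ℝ) : ℝ :=
  p θ (projIcc a b h.le (y θ))

theorem slowness_of_mem (h : IsPolarFlow F p M G a b lo hi c e A B f) {y : ℝ → ℝ} {θ : ℝ}
    (hy : y θ ∈ Icc a b) : h.slowness y θ = p θ (y θ) := by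
  rw [slowness, projIcc_of_mem h.le hy]

theorem continuous_slowness (h : IsPolarFlow F p M G a b lo hi c e A B f) {y : ℝ → ℝ}
    (hy : Continuous y) : Continuous (h.slowness y) := by
  have h1 : Continuous fun θ => (θ, (projIcc a b h.le (y θ) : ℝ)) :=
    continuous_id.prodMk (continuous_subtype_val.comp (continuous_projIcc.comp hy))
  exact h.slowness_cont.comp_continuous h1 fun θ => ⟨mem_univ _, (projIcc a b h.le (y θ)).2⟩

theorem exists_timing (h : IsPolarFlow F p M G a b lo hi c e A B f) {y : ℝ → ℝ}
    (hy : Continuous y) (θ₀ : ℝ) :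
    ∃ τ ϑ : ℝ → ℝ, τ θ₀ = 0 ∧ IsTimeChange (h.slowness y) τ ϑ := by
  obtain ⟨m, hm, hmp⟩ := h.slowness_pos
  exact exists_isTimeChange (h.continuous_slowness hy) hm
    (fun θ => hmp θ _ (projIcc a b h.le (y θ)).2) θ₀

theorem hasDerivAt_curve (h : IsPolarFlow F p M G a b lo hi c e A B f) {y τ ϑ : ℝ → ℝ}
    (hy : h.IsSol y) (hϑ : IsTimeChange (h.slowness y) τ ϑ) {t : ℝ} (ht : y (ϑ t) ∈ Icc a b) :
    HasDerivAt (fun s => polarPoint e A B (ϑ s) (y (ϑ s)))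
      (f (polarPoint e A B (ϑ t) (y (ϑ t)))) t := by
  have h1 := hϑ.hasDerivAt_angle t
  rw [h.slowness_of_mem ht] at h1
  exact h.field ϑ (fun s => y (ϑ s)) t ht h1 ((hy.hasDerivAt ht).comp t h1)

/-- The curve of a solution which approaches the solution `z` exponentially in the angle approaches
a time translate of the curve of `z`: the difference of the two times, as functions of the angle,
has an exponentially decaying derivative and hence a limit, the phase. -/
theorem exists_phase (h : IsPolarFlow F p M G a b lo hi c e A B f) {y z τ ϑ τz ϑz : ℝ → ℝ}
    (hy : h.IsSol y) (hz : h.IsSol z) (hϑ : IsTimeChange (h.slowness y) τ ϑ)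
    (hϑz : IsTimeChange (h.slowness z) τz ϑz) {θ₀ C : ℝ} (hzb : ∀ θ, z θ ∈ Icc a b)
    (hyb : ∀ θ ≥ θ₀, y θ ∈ Icc a b)
    (hyz : ∀ θ ≥ θ₀, |y θ - z θ| ≤ C * Real.exp (-c * (θ - θ₀))) :
    ∃ s, Tendsto (fun t => dist (polarPoint e A B (ϑ t) (y (ϑ t)))
      (polarPoint e A B (ϑz (t + s)) (z (ϑz (t + s))))) atTop (𝓝 0) := by
  obtain ⟨K, hK⟩ := h.slowness_lip
  obtain ⟨m, hm, hmp⟩ := h.slowness_pos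
  obtain ⟨L, hL⟩ := h.bdd
  have hc := h.c_pos
  obtain ⟨l, hl⟩ := exists_tendsto_of_abs_deriv_le_exp (D := fun θ => τ θ - τz θ) (θ₀ := θ₀)
    (C := K * C) hc
    (fun θ => (hϑ.hasDerivAt_time θ).sub (hϑz.hasDerivAt_time θ))
    ((h.continuous_slowness hy.continuous).sub (h.continuous_slowness hz.continuous)) (by
      intro θ hθ
      rw [h.slowness_of_mem (hyb θ hθ), h.slowness_of_mem (hzb θ), mul_assoc]
      exact ((hK θ).dist_le_mul _ (hyb θ hθ) _ (hzb θ)).trans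
        (mul_le_mul_of_nonneg_left (hyz θ hθ) K.2))
  refine ⟨-l, ?_⟩
  -- the two angles at corresponding times
  have hϑlip : ∀ t t', |ϑz t - ϑz t'| ≤ 1 / m * |t - t'| := by
    intro t t'
    have := Convex.norm_image_sub_le_of_norm_hasDerivWithin_le (f := ϑz) (C := 1 / m)
      (s := univ) (fun x _ => (hϑz.hasDerivAt_angle x).hasDerivWithinAt) (fun x _ => by
        have h1 : m ≤ h.slowness z (ϑz x) := hmp _ _ (projIcc a b h.le _).2
        rw [Real.norm_of_nonneg (inv_nonneg.2 (hm.le.trans h1)), ← one_div]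
        exact one_div_le_one_div_of_le hm h1) convex_univ (mem_univ t') (mem_univ t)
    simpa using this
  have hzlip : ∀ θ θ', |z θ - z θ'| ≤ L * |θ - θ'| := by
    intro θ θ'
    have := Convex.norm_image_sub_le_of_norm_hasDerivWithin_le (f := z) (C := L)
      (s := univ) (fun x _ => (hz x).hasDerivWithinAt)
      (fun x _ => hL x _ (projIcc a b h.le _).2) convex_univ (mem_univ θ') (mem_univ θ)
    simpa using this
  have hang : Tendsto (fun t => |ϑ t - ϑz (t + -l)|) atTop (𝓝 0) := by
    have h1 : Tendsto (fun t => |τ (ϑ t) - τz (ϑ t) - l|) atTop (𝓝 0) := by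
      have := ((hl.comp hϑ.tendsto_angle).sub_const l).abs
      simpa using this
    refine squeeze_zero (fun _ => abs_nonneg _) (fun t => ?_)
      (by simpa only [mul_zero] using h1.const_mul (1 / m))
    have h2 := hϑlip (τz (ϑ t)) (t + -l)
    rw [hϑz.angle_time] at h2
    refine h2.trans_eq ?_
    rw [hϑ.time_angle]
    congr 1
    rw [← abs_neg]; congr 1; ring
  have hyz0 : Tendsto (fun t => |y (ϑ t) - z (ϑ t)|) atTop (𝓝 0) := by
    have h1 : Tendsto (fun θ : ℝ => C * Real.exp (-c * (θ - θ₀))) atTop (𝓝 0) := by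
      have h2 : Tendsto (fun θ : ℝ => -c * (θ - θ₀)) atTop atBot :=
        (tendsto_atTop_add_const_right _ (-θ₀) tendsto_id).const_mul_atTop_of_neg
          (neg_neg_of_pos hc)
      simpa using (Real.tendsto_exp_atBot.comp h2).const_mul C
    refine squeeze_zero' (Eventually.of_forall fun _ => abs_nonneg _) ?_
      (h1.comp hϑ.tendsto_angle)
    filter_upwards [hϑ.tendsto_angle.eventually_ge_atTop θ₀] with t ht
    exact hyz _ ht
  have hfin : Tendsto (fun t => max A B * (1 / a * |ϑ t - ϑz (t + -l)| + 1 / a ^ 2 *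
      (|y (ϑ t) - z (ϑ t)| + L * |ϑ t - ϑz (t + -l)|))) atTop (𝓝 0) := by
    simpa only [mul_zero, add_zero] using ((hang.const_mul (1 / a)).add
      ((hyz0.add (hang.const_mul (L : ℝ))).const_mul (1 / a ^ 2))).const_mul (max A B)
  refine squeeze_zero' (Eventually.of_forall fun _ => dist_nonneg) ?_ hfin
  filter_upwards [hϑ.tendsto_angle.eventually_ge_atTop θ₀] with t ht
  refine (dist_polarPoint_le e h.A_pos h.B_pos h.a_pos (hyb _ ht).1 (hzb _).1).trans ?_
  have h3 : |y (ϑ t) - z (ϑz (t + -l))| ≤ |y (ϑ t) - z (ϑ t)| + L * |ϑ t - ϑz (t + -l)| :=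
    (abs_sub_le _ (z (ϑ t)) _).trans (add_le_add_right (hzlip _ _) _)
  have hmax : 0 ≤ max A B := h.A_pos.le.trans (le_max_left _ _)
  gcongr

/-- The time along a periodic solution advances by a fixed period in each turn. -/
theorem exists_period (h : IsPolarFlow F p M G a b lo hi c e A B f) {z τ ϑ : ℝ → ℝ}
    (hper : Function.Periodic z (2 * Real.pi)) (hϑ : IsTimeChange (h.slowness z) τ ϑ) :
    ∃ T > 0, ∀ t, ϑ (t + T) = ϑ t + 2 * Real.pi := by
  have hconst : ∀ θ, τ (θ + 2 * Real.pi) - τ θ = τ (0 + 2 * Real.pi) - τ 0 := by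
    intro θ
    have hd : ∀ θ, HasDerivAt (fun θ => τ (θ + 2 * Real.pi) - τ θ) 0 θ := by
      intro θ
      have h1 := ((hϑ.hasDerivAt_time (θ + 2 * Real.pi)).comp_add_const θ (2 * Real.pi)).sub
        (hϑ.hasDerivAt_time θ)
      have h2 : h.slowness z (θ + 2 * Real.pi) = h.slowness z θ := by
        simp only [slowness, hper θ, h.slowness_periodic]
      rwa [h2, sub_self] at h1
    exact is_const_of_deriv_eq_zero (fun θ => (hd θ).differentiableAt) (fun θ => (hd θ).deriv) θ 0
  refine ⟨τ (0 + 2 * Real.pi) - τ 0, ?_, fun t => ?_⟩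
  · have h1 : ϑ (τ 0) < ϑ (τ (0 + 2 * Real.pi)) := by
      rw [hϑ.angle_time, hϑ.angle_time]; linarith [Real.pi_pos]
    exact sub_pos.2 (hϑ.strictMono.lt_iff_lt.1 h1)
  · have h1 := hconst (ϑ t)
    rw [hϑ.time_angle] at h1
    rw [← h1, add_sub_cancel, hϑ.angle_time]

/-- A planar system in contracting polar form has a periodic solution winding once around the
centre, and nearby points are the starting points of solutions which stay near its orbit and
approach it with an asymptotic phase. -/
theorem exists_attracting_cycle (h : IsPolarFlow F p M G a b lo hi c e A B f) :
    ∃ (γ : ℝ → ℝ × ℝ) (T : ℝ), IsPeriodicSolution f γ T ∧ WindsOnceClockwise γ T e ∧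
      (∀ t, ∃ θ, ∃ y ∈ Icc a b, γ t = polarPoint e A B θ y) ∧
      ∀ η > 0, ∃ d > 0, ∀ p₀, Metric.infDist p₀ (range γ) < d →
        ∃ σ : ℝ → ℝ × ℝ, σ 0 = p₀ ∧ IsIntegralCurveOn σ (fun _ => f) (Ici 0) ∧
          (∀ t ≥ 0, Metric.infDist (σ t) (range γ) < η) ∧
          ∃ s, Tendsto (fun t => dist (σ t) (γ (t + s))) atTop (𝓝 0) := by
  obtain ⟨z, hz, hper, hin⟩ := h.exists_periodic
  have hzb : ∀ θ, z θ ∈ Icc a b := fun θ => Ioo_subset_Icc_self (hin θ).1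
  have hzpos : ∀ θ, 0 < z θ := fun θ => h.a_pos.trans_le (hzb θ).1
  have hA := h.A_pos
  have hB := h.B_pos
  have ha := h.a_pos
  obtain ⟨τz, ϑz, -, hϑz⟩ := h.exists_timing hz.continuous 0
  obtain ⟨T, hT, hϑT⟩ := h.exists_period hper hϑz
  set γ : ℝ → ℝ × ℝ := fun t => polarPoint e A B (ϑz t) (z (ϑz t)) with hγ
  have hϑc : Continuous ϑz := continuous_iff_continuousAt.2 fun t =>
    (hϑz.hasDerivAt_angle t).continuousAt
  have hrange : range γ = range fun θ => polarPoint e A B θ (z θ) := by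
    refine Subset.antisymm ?_ ?_
    · rintro _ ⟨t, rfl⟩
      exact ⟨ϑz t, rfl⟩
    · rintro _ ⟨θ, rfl⟩
      exact ⟨τz θ, by simp only [hγ, hϑz.angle_time]⟩
  refine ⟨γ, T, ⟨fun t => h.hasDerivAt_curve hz hϑz (hzb _), hT, fun t => ?_, ?_⟩, ?_,
    fun t => ⟨_, _, hzb _, rfl⟩, ?_⟩
  · simp only [hγ, hϑT, hper _, polarPoint_add_two_pi]
  · refine ⟨τz 0, τz Real.pi, fun heq => ?_⟩
    have h1 := congrArg Prod.fst heq
    simp only [hγ, hϑz.angle_time, polarPoint, Real.cos_zero, Real.cos_pi] at h1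
    have h2 : 0 < A * 1 / z 0 := div_pos (by linarith) (hzpos 0)
    have h3 : A * -1 / z Real.pi < 0 := div_neg_of_neg_of_pos (by linarith) (hzpos _)
    linarith
  · obtain ⟨R, ψ, hR, hψ, hRpos, hcos, hsin, hψ2⟩ := exists_ellipse_angle hA hB
    refine ⟨fun t => R (ϑz t) / z (ϑz t), fun t => -ψ (ϑz t), ?_, (hψ.comp hϑc).neg, fun t => ?_,
      fun t => ?_⟩
    · exact (hR.comp hϑc).div (hz.continuous.comp hϑc) fun t => (hzpos _).ne'
    · refine ⟨div_pos (hRpos _) (hzpos _), ?_⟩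
      simp only [hγ, polarPoint, Real.cos_neg, Real.sin_neg, hcos, hsin]
      ext <;> simp only <;> ring
    · simp only [hϑT, hψ2]; ring
  · intro η hη
    obtain ⟨d₁, hd₁, hattr⟩ := hz.exists_attracting hper hin
    set κ : ℝ := max A B * (1 / a ^ 2 * 3) with hκ
    have hκpos : 0 < κ := by
      have : 0 < max A B := hA.trans_le (le_max_left _ _)
      positivity
    obtain ⟨d, hd, hnear⟩ := exists_polar_of_infDist_lt e hA hB hz.continuous hper hzpos
      (η := min d₁ (η / κ)) (lt_min hd₁ (by positivity))
    refine ⟨d, hd, fun p₀ hp₀ => ?_⟩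
    rw [hrange] at hp₀
    obtain ⟨θ₀, y₀, rfl, hy₀⟩ := hnear p₀ hp₀
    obtain ⟨y, hy, rfl⟩ := h.exists_isSol θ₀ y₀
    obtain ⟨hyb, hyz⟩ := hattr y θ₀ hy (hy₀.trans_le (min_le_left _ _))
    obtain ⟨τ, ϑ, hτ0, hϑ⟩ := h.exists_timing hy.continuous θ₀
    have hϑ0 : ϑ 0 = θ₀ := by rw [← hτ0, hϑ.angle_time]
    have hge : ∀ t ≥ 0, θ₀ ≤ ϑ t := fun t ht => by
      rw [← hϑ0]; exact hϑ.strictMono.monotone ht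
    refine ⟨fun t => polarPoint e A B (ϑ t) (y (ϑ t)), by simp only [hϑ0], fun t ht =>
      (h.hasDerivAt_curve hy hϑ (hyb _ (hge t ht))).hasDerivWithinAt, fun t ht => ?_, ?_⟩
    · have h1 : polarPoint e A B (ϑ t) (z (ϑ t)) ∈ range γ := by
        rw [hrange]; exact ⟨ϑ t, rfl⟩
      refine (Metric.infDist_le_dist_of_mem h1).trans_lt ?_
      refine (dist_polarPoint_le e hA hB ha (hyb _ (hge t ht)).1 (hzb _).1).trans_lt ?_
      have h2 : Real.exp (-c * (ϑ t - θ₀)) ≤ 1 :=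
        Real.exp_le_one_iff.2 (by nlinarith [h.c_pos, hge t ht])
      have h3 : |y (ϑ t) - z (ϑ t)| ≤ 3 * |y θ₀ - z θ₀| := by
        refine (hyz _ (hge t ht)).trans ?_
        calc 3 * Real.exp (-c * (ϑ t - θ₀)) * |y θ₀ - z θ₀| ≤ 3 * 1 * |y θ₀ - z θ₀| := by gcongr
          _ = _ := by ring
      have h4 : κ * |y θ₀ - z θ₀| < η := by
        have := hy₀.trans_le (min_le_right _ _)
        rw [lt_div_iff₀ hκpos] at this
        linarith
      rw [sub_self, abs_zero, mul_zero, zero_add]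
      have hmax : 0 ≤ max A B := hA.le.trans (le_max_left _ _)
      calc max A B * (1 / a ^ 2 * |y (ϑ t) - z (ϑ t)|)
          ≤ max A B * (1 / a ^ 2 * (3 * |y θ₀ - z θ₀|)) := by gcongr
        _ = κ * |y θ₀ - z θ₀| := by rw [hκ]; ring
        _ < η := h4
    · refine h.exists_phase hy hz hϑ hϑz (θ₀ := θ₀) (C := 3 * |y θ₀ - z θ₀|) hzb hyb
        fun θ hθ => (hyz θ hθ).trans_eq (by ring)

end IsPolarFlow

/-! ### Orbits with asymptotic phase -/

/-- Points near the orbit of `γ` are starting points of forward solutions which stay near the orbit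
and approach a time translate of `γ`. -/
def HasAsymptoticPhase (f : ℝ × ℝ → ℝ × ℝ) (γ : ℝ → ℝ × ℝ) : Prop :=
  ∀ η > 0, ∃ d > 0, ∀ p₀, Metric.infDist p₀ (range γ) < d →
    ∃ σ : ℝ → ℝ × ℝ, σ 0 = p₀ ∧ IsIntegralCurveOn σ (fun _ => f) (Ici 0) ∧
      (∀ t ≥ 0, Metric.infDist (σ t) (range γ) < η) ∧
      ∃ s, Tendsto (fun t => dist (σ t) (γ (t + s))) atTop (𝓝 0)

namespace HasAsymptoticPhase

variable {f : ℝ × ℝ → ℝ × ℝ} {γ : ℝ → ℝ × ℝ}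

/-- By uniqueness, the properties hold for every solution that starts near the orbit. -/
theorem forall_curve (h : HasAsymptoticPhase f γ) (hf : LocallyLipschitz f) {η : ℝ} (hη : 0 < η) :
    ∃ d > 0, ∀ σ : ℝ → ℝ × ℝ, IsIntegralCurveOn σ (fun _ => f) (Ici 0) →
      Metric.infDist (σ 0) (range γ) < d →
      (∀ t ≥ 0, Metric.infDist (σ t) (range γ) < η) ∧
      ∃ s, Tendsto (fun t => dist (σ t) (γ (t + s))) atTop (𝓝 0) := by
  obtain ⟨d, hd, hD⟩ := h η hη
  refine ⟨d, hd, fun σ hσ h0 => ?_⟩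
  obtain ⟨σ', h0', hσ', hnear, s, hs⟩ := hD _ h0
  have heq : EqOn σ' σ (Ici 0) := hσ'.eqOn_Ici hf hσ h0'
  refine ⟨fun t ht => heq (mem_Ici.2 ht) ▸ hnear t ht, s, hs.congr' ?_⟩
  filter_upwards [eventually_ge_atTop 0] with t ht
  rw [heq (mem_Ici.2 ht)]

theorem tendsto_infDist {σ : ℝ → ℝ × ℝ} {s : ℝ}
    (hs : Tendsto (fun t => dist (σ t) (γ (t + s))) atTop (𝓝 0)) :
    Tendsto (fun t => Metric.infDist (σ t) (range γ)) atTop (𝓝 0) :=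
  squeeze_zero (fun _ => Metric.infDist_nonneg)
    (fun _ => Metric.infDist_le_dist_of_mem (mem_range_self _)) hs

theorem isAsymptoticallyStableOrbit (h : HasAsymptoticPhase f γ) (hf : LocallyLipschitz f) :
    IsAsymptoticallyStableOrbit f (range γ) := by
  refine ⟨fun η hη => ?_, ?_⟩
  · obtain ⟨d, hd, hD⟩ := h.forall_curve hf hη
    exact ⟨d, hd, fun σ hσ h0 => (hD σ hσ h0).1⟩
  · obtain ⟨d₁, hd₁, hD₁⟩ := h 1 one_pos
    obtain ⟨d₂, hd₂, hD₂⟩ := h.forall_curve hf one_pos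
    refine ⟨min d₁ d₂, lt_min hd₁ hd₂, fun p hp => ?_, fun σ hσ h0 => ?_⟩
    · obtain ⟨σ, h0, hσ, -⟩ := hD₁ p (hp.trans_le (min_le_left _ _))
      exact ⟨σ, h0, hσ⟩
    · obtain ⟨-, s, hs⟩ := hD₂ σ hσ (h0.trans_le (min_le_right _ _))
      exact tendsto_infDist hs

theorem range_subset_of_eqOn {σ : ℝ → ℝ × ℝ} {S u v : ℝ} (hS : 0 < S)
    (hper : Function.Periodic σ S) (heq : EqOn (fun t => σ (t + u)) (fun t => γ (t + v)) (Ici 0)) :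
    range σ ⊆ range γ := by
  rintro _ ⟨x, rfl⟩
  obtain ⟨n, hn⟩ := exists_nat_gt ((u - x) / S)
  rw [div_lt_iff₀ hS] at hn
  have h1 := heq (show x - u + n * S ∈ Ici 0 by simp only [mem_Ici]; linarith)
  refine ⟨_, h1.symm.trans ?_⟩
  simp only
  rw [show x - u + n * S + u = x + n * S by ring]
  exact hper.nat_mul n x

/-- A periodic orbit near the orbit of `γ` converges to it, hence lies on it. -/
theorem isLimitCycle (h : HasAsymptoticPhase f γ) (hf : LocallyLipschitz f) {T : ℝ}
    (hγ : IsPeriodicSolution f γ T) : IsLimitCycle f γ T := by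
  obtain ⟨d, hd, hD⟩ := h.forall_curve hf one_pos
  refine ⟨hγ, d, hd, ?_⟩
  rintro σ S ⟨hσ, hS, hσper, -⟩ ⟨t₀, ht₀⟩
  obtain ⟨hγc, hT, hγper, -⟩ := hγ
  have hσ₀ := ((hσ.isIntegralCurveOn (Ici t₀)).comp_add_Ici t₀)
  rw [sub_self] at hσ₀
  obtain ⟨-, s, hs⟩ := hD _ hσ₀ (by simpa using ht₀)
  have hlim := tendsto_infDist hs
  have hzero : Metric.infDist (σ t₀) (range γ) = 0 := by
    have h1 : Tendsto (fun n : ℕ => (n : ℝ) * S) atTop atTop :=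
      tendsto_natCast_atTop_atTop.atTop_mul_const hS
    refine tendsto_nhds_unique (f := fun _ : ℕ => Metric.infDist (σ t₀) (range γ)) (l := atTop)
      tendsto_const_nhds ((hlim.comp h1).congr fun n => ?_)
    have h2 : σ (n * S + t₀) = σ t₀ := by rw [add_comm]; exact hσper.nat_mul n t₀
    simp only [Function.comp_apply, h2]
  have hcl : IsClosed (range γ) :=
    (hγper.compact_of_continuous hT.ne' hγc.continuous).isClosed
  obtain ⟨t₁, ht₁⟩ : σ t₀ ∈ range γ :=
    (hcl.mem_iff_infDist_zero (range_nonempty γ)).2 hzero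
  have hγ₁ := ((hγc.isIntegralCurveOn (Ici t₁)).comp_add_Ici t₁)
  rw [sub_self] at hγ₁
  have heq := hσ₀.eqOn_Ici hf hγ₁ (by simpa using ht₁.symm)
  exact Subset.antisymm (range_subset_of_eqOn hS hσper heq)
    (range_subset_of_eqOn hT hγper heq.symm)

end HasAsymptoticPhase

/-! ### The forced system and the co-moving system -/

theorem locallyLipschitz_comovingField (N : ℕ) (ε r : ℝ) :
    LocallyLipschitz (comovingField N ε r) := by
  have : ContDiff ℝ 1 (comovingField N ε r) := by
    unfold comovingField
    fun_prop
  exact this.locallyLipschitz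

theorem hasDerivWithinAt_spiralCurve {N : ℕ} {ε r : ℝ} {γ : ℝ → ℝ × ℝ} {s : Set ℝ} {t : ℝ}
    (h : HasDerivWithinAt γ (comovingField N ε r (γ t)) s t) :
    HasDerivWithinAt (spiralCurve r γ) (forcedField N ε r (spiralCurve r γ t)) s t := by
  have h1 : HasDerivWithinAt (fun t => (γ t).1) (comovingField N ε r (γ t)).1 s t :=
    h.hasFDerivWithinAt.fst.hasDerivWithinAt.congr_deriv (by simp)
  have h2 : HasDerivWithinAt (fun t => (γ t).2) (comovingField N ε r (γ t)).2 s t :=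
    h.hasFDerivWithinAt.snd.hasDerivWithinAt.congr_deriv (by simp)
  have h3 : HasDerivWithinAt (fun t => r * t) r s t := by
    simpa using ((hasDerivAt_id t).const_mul r).hasDerivWithinAt
  refine (h1.prodMk ((h2.sub h3).prodMk h3)).congr_deriv ?_
  simp only [forcedField, spiralCurve, comovingField]
  ext <;> simp

theorem hasDerivWithinAt_toComoving {N : ℕ} {ε r : ℝ} {q : ℝ → ℝ × ℝ × ℝ} {s : Set ℝ} {t : ℝ}
    (h : HasDerivWithinAt q (forcedField N ε r (q t)) s t) :
    HasDerivWithinAt (fun t => toComoving (q t)) (comovingField N ε r (toComoving (q t))) s t := by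
  have h1 : HasDerivWithinAt (fun t => (q t).1) (forcedField N ε r (q t)).1 s t :=
    h.hasFDerivWithinAt.fst.hasDerivWithinAt.congr_deriv (by simp)
  have h2 : HasDerivWithinAt (fun t => (q t).2.1) (forcedField N ε r (q t)).2.1 s t :=
    h.hasFDerivWithinAt.snd.fst.hasDerivWithinAt.congr_deriv (by simp)
  have h3 : HasDerivWithinAt (fun t => (q t).2.2) (forcedField N ε r (q t)).2.2 s t :=
    h.hasFDerivWithinAt.snd.snd.hasDerivWithinAt.congr_deriv (by simp)
  exact h1.prodMk (h2.add h3)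

/-- A trajectory of the forced system with `lam = r t` is the spiral curve of its co-moving
trajectory. -/
theorem eqOn_spiralCurve_toComoving {N : ℕ} {ε r t₀ : ℝ} {q : ℝ → ℝ × ℝ × ℝ}
    (hq : IsIntegralCurveOn q (fun _ => forcedField N ε r) (Ici t₀)) (h0 : (q t₀).2.2 = r * t₀) :
    EqOn q (spiralCurve r fun t => toComoving (q t)) (Ici t₀) := by
  have h1 : EqOn (fun t => (q t).2.2) (fun t => r * t) (Ici t₀) :=
    IsIntegralCurveOn.eqOn_Ici (f := fun _ : ℝ => r) (LocallyLipschitz.const r)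
      (fun t ht => (hq t ht).hasFDerivWithinAt.snd.snd.hasDerivWithinAt.congr_deriv
        (by simp [forcedField]))
      (fun t _ => by simpa using ((hasDerivAt_id t).const_mul r).hasDerivWithinAt) h0
  intro t ht
  have h2 : (q t).2.2 = r * t := h1 ht
  simp only [spiralCurve, toComoving]
  ext <;> simp [h2]

theorem dist_spiralCurve (r : ℝ) (γ₁ γ₂ : ℝ → ℝ × ℝ) (t : ℝ) :
    dist (spiralCurve r γ₁ t) (spiralCurve r γ₂ t) = dist (γ₁ t) (γ₂ t) := by
  simp [spiralCurve, Prod.dist_eq]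

/-- Trajectories of the forced system which start near a spiral curve follow it, if the underlying
periodic orbit of the co-moving system attracts with asymptotic phase. -/
theorem HasAsymptoticPhase.forced_tracking {N : ℕ} {ε r : ℝ} {γ : ℝ → ℝ × ℝ}
    (h : HasAsymptoticPhase (comovingField N ε r) γ) :
    ∃ d > 0, ∀ (t₀ : ℝ) (q₀ : ℝ × ℝ × ℝ), q₀.2.2 = r * t₀ →
      Metric.infDist (toComoving q₀) (range γ) < d →
      (∃ q : ℝ → ℝ × ℝ × ℝ, q t₀ = q₀ ∧
        IsIntegralCurveOn q (fun _ => forcedField N ε r) (Ici t₀)) ∧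
      ∀ q : ℝ → ℝ × ℝ × ℝ, q t₀ = q₀ →
        IsIntegralCurveOn q (fun _ => forcedField N ε r) (Ici t₀) →
        ∃ θ : ℝ, Tendsto
          (fun t => dist (q t) (spiralCurve r (fun s => γ (s + θ)) t)) atTop (𝓝 0) := by
  obtain ⟨d₁, hd₁, hD₁⟩ := h 1 one_pos
  obtain ⟨d₂, hd₂, hD₂⟩ := h.forall_curve (locallyLipschitz_comovingField N ε r) one_pos
  refine ⟨min d₁ d₂, lt_min hd₁ hd₂, fun t₀ q₀ hlam hq₀ => ⟨?_, fun q hq0 hq => ?_⟩⟩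
  · obtain ⟨σ, h0, hσ, -⟩ := hD₁ _ (hq₀.trans_le (min_le_left _ _))
    have hσ' := hσ.comp_add_Ici (-t₀)
    rw [zero_sub, neg_neg] at hσ'
    refine ⟨spiralCurve r fun t => σ (t + -t₀), ?_, fun t ht =>
      hasDerivWithinAt_spiralCurve (hσ' t ht)⟩
    simp only [spiralCurve, add_neg_cancel, h0, toComoving, ← hlam]
    ext <;> simp
  · have hw : IsIntegralCurveOn (fun t => toComoving (q t)) (fun _ => comovingField N ε r)
        (Ici t₀) := fun t ht => hasDerivWithinAt_toComoving (hq t ht)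
    have hw' := hw.comp_add_Ici t₀
    rw [sub_self] at hw'
    obtain ⟨-, s, hs⟩ := hD₂ _ hw' (by
      rw [zero_add, hq0]; exact hq₀.trans_le (min_le_right _ _))
    refine ⟨s - t₀, (hs.comp (tendsto_atTop_add_const_right _ (-t₀) tendsto_id)).congr' ?_⟩
    filter_upwards [eventually_ge_atTop t₀] with t ht
    rw [eqOn_spiralCurve_toComoving hq (by rw [hq0]; exact hlam) (mem_Ici.2 ht), dist_spiralCurve]
    simp only [Function.comp_apply, id]
    rw [show t + -t₀ + t₀ = t by ring, show t + -t₀ + s = t + (s - t₀) by ring]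

/-! ### Uniformly bounded and uniformly Lipschitz families -/

/-- A family of functions which is uniformly bounded and uniformly Lipschitz on `J`. -/
def UnifLip {ι : Type*} (I : Set ι) (J : Set ℝ) (φ : ι → ℝ → ℝ) : Prop :=
  ∃ C : ℝ, ∀ i ∈ I, (∀ y ∈ J, |φ i y| ≤ C) ∧
    ∀ y₁ ∈ J, ∀ y₂ ∈ J, |φ i y₁ - φ i y₂| ≤ C * |y₁ - y₂|

namespace UnifLip

variable {ι : Type*} {I I' : Set ι} {J : Set ℝ} {φ ψ : ι → ℝ → ℝ}

theorem mono (h : UnifLip I J φ) (hI : I' ⊆ I) : UnifLip I' J φ :=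
  let ⟨C, hC⟩ := h
  ⟨C, fun i hi => hC i (hI hi)⟩

theorem exists_pos (h : UnifLip I J φ) : ∃ C > 0, ∀ i ∈ I, (∀ y ∈ J, |φ i y| ≤ C) ∧
    ∀ y₁ ∈ J, ∀ y₂ ∈ J, |φ i y₁ - φ i y₂| ≤ C * |y₁ - y₂| := by
  obtain ⟨C, hC⟩ := h
  have hCC : C ≤ max C 1 := le_max_left _ _
  refine ⟨max C 1, by positivity, fun i hi => ⟨fun y hy => ((hC i hi).1 y hy).trans hCC,
    fun y₁ h₁ y₂ h₂ => ((hC i hi).2 y₁ h₁ y₂ h₂).trans ?_⟩⟩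
  gcongr

theorem of_const {g : ι → ℝ} {C : ℝ} (h : ∀ i ∈ I, |g i| ≤ C) : UnifLip I J fun i _ => g i := by
  refine ⟨max C 0, fun i hi => ⟨fun _ _ => (h i hi).trans (le_max_left _ _), fun y₁ _ y₂ _ => ?_⟩⟩
  rw [sub_self, abs_zero]
  positivity

theorem add (hφ : UnifLip I J φ) (hψ : UnifLip I J ψ) : UnifLip I J fun i y => φ i y + ψ i y := by
  obtain ⟨C, hC⟩ := hφ
  obtain ⟨C', hC'⟩ := hψ
  refine ⟨C + C', fun i hi => ⟨fun y hy => (abs_add_le _ _).trans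
    (add_le_add ((hC i hi).1 y hy) ((hC' i hi).1 y hy)), fun y₁ h₁ y₂ h₂ => ?_⟩⟩
  rw [add_sub_add_comm, add_mul]
  exact (abs_add_le _ _).trans (add_le_add ((hC i hi).2 y₁ h₁ y₂ h₂) ((hC' i hi).2 y₁ h₁ y₂ h₂))

theorem neg (hφ : UnifLip I J φ) : UnifLip I J fun i y => -φ i y := by
  obtain ⟨C, hC⟩ := hφ
  refine ⟨C, fun i hi => ⟨fun y hy => by rw [abs_neg]; exact (hC i hi).1 y hy,
    fun y₁ h₁ y₂ h₂ => ?_⟩⟩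
  rw [neg_sub_neg, abs_sub_comm]
  exact (hC i hi).2 y₁ h₁ y₂ h₂

theorem sub (hφ : UnifLip I J φ) (hψ : UnifLip I J ψ) : UnifLip I J fun i y => φ i y - ψ i y := by
  simpa only [sub_eq_add_neg] using hφ.add hψ.neg

theorem mul (hφ : UnifLip I J φ) (hψ : UnifLip I J ψ) : UnifLip I J fun i y => φ i y * ψ i y := by
  obtain ⟨C, hC0, hC⟩ := hφ.exists_pos
  obtain ⟨C', hC0', hC'⟩ := hψ.exists_pos
  refine ⟨max (C * C') (2 * (C * C')), fun i hi => ⟨fun y hy => ?_, fun y₁ h₁ y₂ h₂ => ?_⟩⟩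
  · rw [abs_mul]
    exact (mul_le_mul ((hC i hi).1 y hy) ((hC' i hi).1 y hy) (abs_nonneg _) hC0.le).trans
      (le_max_left _ _)
  · have h1 : φ i y₁ * ψ i y₁ - φ i y₂ * ψ i y₂ =
        φ i y₁ * (ψ i y₁ - ψ i y₂) + (φ i y₁ - φ i y₂) * ψ i y₂ := by ring
    rw [h1]
    calc |φ i y₁ * (ψ i y₁ - ψ i y₂) + (φ i y₁ - φ i y₂) * ψ i y₂|
        ≤ |φ i y₁| * |ψ i y₁ - ψ i y₂| + |φ i y₁ - φ i y₂| * |ψ i y₂| := by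
          rw [← abs_mul, ← abs_mul]; exact abs_add_le _ _
      _ ≤ C * (C' * |y₁ - y₂|) + C * |y₁ - y₂| * C' := by
          gcongr
          · exact (hC i hi).1 y₁ h₁
          · exact (hC' i hi).2 y₁ h₁ y₂ h₂
          · exact (hC i hi).2 y₁ h₁ y₂ h₂
          · exact (hC' i hi).1 y₂ h₂
      _ = 2 * (C * C') * |y₁ - y₂| := by ring
      _ ≤ _ := by gcongr; exact le_max_right _ _

theorem pow (hφ : UnifLip I J φ) (k : ℕ) : UnifLip I J fun i y => φ i y ^ k := by
  induction k with
  | zero => simpa using of_const (J := J) (g := fun _ : ι => (1 : ℝ)) (C := 1) (I := I) (by simp)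
  | succ k ih => simpa only [pow_succ] using ih.mul hφ

theorem inv (hφ : UnifLip I J φ) {m : ℝ} (hm : 0 < m) (h : ∀ i ∈ I, ∀ y ∈ J, m ≤ φ i y) :
    UnifLip I J fun i y => (φ i y)⁻¹ := by
  obtain ⟨C, hC0, hC⟩ := hφ.exists_pos
  have hpos : ∀ i ∈ I, ∀ y ∈ J, 0 < φ i y := fun i hi y hy => hm.trans_le (h i hi y hy)
  have hinv : ∀ i ∈ I, ∀ y ∈ J, |(φ i y)⁻¹| ≤ m⁻¹ := fun i hi y hy => by
    rw [abs_of_pos (inv_pos.2 (hpos i hi y hy))]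
    exact inv_anti₀ hm (h i hi y hy)
  refine ⟨max m⁻¹ (m⁻¹ * m⁻¹ * C), fun i hi => ⟨fun y hy => (hinv i hi y hy).trans
    (le_max_left _ _), fun y₁ h₁ y₂ h₂ => ?_⟩⟩
  have h1 : (φ i y₁)⁻¹ - (φ i y₂)⁻¹ = (φ i y₁)⁻¹ * (φ i y₂)⁻¹ * (φ i y₂ - φ i y₁) := by
    have h2 := (hpos i hi y₁ h₁).ne'
    have h3 := (hpos i hi y₂ h₂).ne'
    field_simp
  rw [h1, abs_mul, abs_mul, abs_sub_comm]
  calc |(φ i y₁)⁻¹| * |(φ i y₂)⁻¹| * |φ i y₁ - φ i y₂|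
      ≤ m⁻¹ * m⁻¹ * (C * |y₁ - y₂|) := by
        gcongr
        · exact hinv i hi y₁ h₁
        · exact hinv i hi y₂ h₂
        · exact (hC i hi).2 y₁ h₁ y₂ h₂
    _ = m⁻¹ * m⁻¹ * C * |y₁ - y₂| := by ring
    _ ≤ _ := by gcongr; exact le_max_right _ _

end UnifLip

/-! ### Averaging near a Hopf point -/

/-- Coefficients of the rescaled system
`X' = Y + s κ (X² + s (b / 2) X)`, `Y' = -X - s (b X² + s b₃ X³ + s² X⁴ Q (s X))`,
the normal form near the equilibrium with amplitude scale `s`. -/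
structure HopfData where
  κ : ℝ
  b : ℝ
  b₃ : ℝ
  s : ℝ
  Q : ℝ → ℝ

namespace HopfData

/-- Bounds, uniform in `s`, on the coefficients. -/
structure BoundedBy (P : HopfData) (K : ℝ) : Prop where
  K_pos : 0 < K
  κ_mem : P.κ ∈ Icc K⁻¹ K
  b_mem : P.b ∈ Icc K⁻¹ K
  b₃_le : |P.b₃| ≤ K
  s_mem : P.s ∈ Ioc 0 1
  continuous_Q : Continuous P.Q
  Q_le : ∀ u ∈ Icc (-2 : ℝ) 2, |P.Q u| ≤ K
  Q_lip : ∀ u ∈ Icc (-2 : ℝ) 2, ∀ v ∈ Icc (-2 : ℝ) 2, |P.Q u - P.Q v| ≤ K * |u - v|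

/-! In the polar coordinates `X = cos θ / y`, `Y = -sin θ / y` the system is
`θ' = D`, `y' = -s n`, and `n`, `D` are expanded in powers of `s`. -/

noncomputable section

variable (P : HopfData) (θ y : ℝ)

/-- The quartic coefficient `Q (s X)` in polar coordinates. -/
def q : ℝ := P.Q (P.s * Real.cos θ / y)
/-- The zeroth order term of `n` in `s`. It does not depend on `y`, since `y` is the inverse
radius. -/
def n₀ : ℝ := P.κ * Real.cos θ ^ 3 + P.b * Real.cos θ ^ 2 * Real.sin θ
/-- Terms of `n` of first order in `s`. -/
def n₁ : ℝ := P.κ * (P.b / 2) * Real.cos θ ^ 2 * y + P.b₃ * Real.cos θ ^ 3 * Real.sin θ * y⁻¹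
/-- Terms of `n` of second and higher order in `s`. -/
def n₂ : ℝ := Real.sin θ * Real.cos θ ^ 4 * P.q θ y * y⁻¹ ^ 2
/-- The velocity of the inverse radius, up to the factor `-s`. -/
def n : ℝ := P.n₀ θ + P.s * (P.n₁ θ y + P.s * P.n₂ θ y)
/-- Angular part of the zeroth order term `m₀ θ * y⁻¹` of `d`. -/
def m₀ : ℝ := P.b * Real.cos θ ^ 3 - P.κ * Real.cos θ ^ 2 * Real.sin θ
/-- Terms of `d` of first order in `s`. -/
def d₁ : ℝ := P.b₃ * Real.cos θ ^ 4 * y⁻¹ ^ 2 - P.κ * (P.b / 2) * Real.cos θ * Real.sin θ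
/-- Terms of `d` of second and higher order in `s`. -/
def d₂ : ℝ := Real.cos θ ^ 5 * P.q θ y * y⁻¹ ^ 3
/-- The deviation of the angular velocity from `1`, up to the factor `s`. -/
def d : ℝ := P.m₀ θ * y⁻¹ + P.s * (P.d₁ θ y + P.s * P.d₂ θ y)
/-- The angular velocity. -/
def D : ℝ := 1 + P.s * P.d θ y
/-- The equation for the inverse radius as a function of the angle is `dy/dθ = F θ y`. -/
def F : ℝ := -P.s * P.n θ y * (P.D θ y)⁻¹

/-- Periodic antiderivative of `n₀`. -/
def a : ℝ := P.κ * (Real.sin θ - Real.sin θ ^ 3 / 3) - P.b * Real.cos θ ^ 3 / 3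
/-- Periodic antiderivative of the oscillating part of the second order terms linear in `y`. -/
def α : ℝ := P.κ * (P.b / 2) * (Real.sin θ * Real.cos θ / 2)
/-- Periodic antiderivative of the oscillating part of the second order terms in `y⁻¹`. -/
def β : ℝ := -P.b₃ * Real.cos θ ^ 4 / 4 -
  (P.κ * P.b * (Real.cos θ ^ 5 * Real.sin θ / 3 + Real.cos θ ^ 3 * Real.sin θ / 6 +
    Real.cos θ * Real.sin θ / 4) - (P.b ^ 2 - P.κ ^ 2) * Real.cos θ ^ 6 / 6)
/-- The averaged coordinate: the terms of first and second order in `s` that depend on `θ` are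
removed from its derivative. -/
def M : ℝ := y + (P.s * P.a θ + P.s ^ 2 * (P.α θ * y + P.β θ * y⁻¹))
/-- The remainder of third order after averaging. -/
def E : ℝ := -(P.n₂ θ y - P.n₀ θ * (P.d₁ θ y + P.s * P.d₂ θ y) -
    (P.n₁ θ y + P.s * P.n₂ θ y) * P.d θ y + P.n θ y * P.d θ y ^ 2 * (P.D θ y)⁻¹) -
  P.n θ y * (P.D θ y)⁻¹ * (P.α θ - P.β θ * y⁻¹ ^ 2)
/-- The derivative of the averaged coordinate along solutions. -/
def G : ℝ := -(P.s ^ 2 * (P.κ * P.b / 4) * (y - y⁻¹)) + P.s ^ 3 * P.E θ y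

end

variable {P : HopfData}

theorem hasDerivAt_a (θ : ℝ) : HasDerivAt P.a (P.n₀ θ) θ := by
  have hs := Real.hasDerivAt_sin θ
  have hc := Real.hasDerivAt_cos θ
  have h := ((hs.sub ((hs.fun_pow 3).div_const 3)).const_mul P.κ).sub
    (((hc.fun_pow 3).const_mul P.b).div_const 3)
  refine h.congr_deriv ?_
  have := Real.sin_sq_add_cos_sq θ
  simp only [n₀]
  push_cast
  linear_combination (-P.κ * Real.cos θ) * this

theorem hasDerivAt_α (θ : ℝ) :
    HasDerivAt P.α (P.κ * (P.b / 2) * (Real.cos θ ^ 2 - 1 / 2)) θ := by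
  have hs := Real.hasDerivAt_sin θ
  have hc := Real.hasDerivAt_cos θ
  have h := ((hs.mul hc).div_const 2).const_mul (P.κ * (P.b / 2))
  refine h.congr_deriv ?_
  have := Real.sin_sq_add_cos_sq θ
  linear_combination (-P.κ * (P.b / 2) / 2) * this

theorem hasDerivAt_β (θ : ℝ) :
    HasDerivAt P.β (P.b₃ * Real.cos θ ^ 3 * Real.sin θ - P.n₀ θ * P.m₀ θ + P.κ * P.b / 4) θ := by
  have hs := Real.hasDerivAt_sin θ
  have hc := Real.hasDerivAt_cos θ
  have h := (((hc.fun_pow 4).const_mul (-P.b₃)).div_const 4).sub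
    ((((((hc.fun_pow 5).mul hs).div_const 3).add (((hc.fun_pow 3).mul hs).div_const 6)).add
      ((hc.mul hs).div_const 4)).const_mul (P.κ * P.b) |>.sub
      (((hc.fun_pow 6).const_mul (P.b ^ 2 - P.κ ^ 2)).div_const 6))
  refine h.congr_deriv ?_
  have h2 : Real.sin θ ^ 2 = 1 - Real.cos θ ^ 2 := by
    linear_combination Real.sin_sq_add_cos_sq θ
  simp only [n₀, m₀]
  push_cast
  ring_nf
  rw [h2]
  ring

/-- The averaging computation. -/
theorem hasDerivAt_M {y : ℝ → ℝ} {θ : ℝ} (hy0 : y θ ≠ 0) (hD : P.D θ (y θ) ≠ 0)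
    (hy : HasDerivAt y (P.F θ (y θ)) θ) :
    HasDerivAt (fun τ => P.M τ (y τ)) (P.G θ (y θ)) θ := by
  have h := hy.add (((hasDerivAt_a (P := P) θ).const_mul P.s).add
    ((((hasDerivAt_α (P := P) θ).mul hy).add
      ((hasDerivAt_β (P := P) θ).mul (hy.fun_inv hy0))).const_mul (P.s ^ 2)))
  refine h.congr_deriv ?_
  have hdef : P.D θ (y θ) = 1 + P.s * P.d θ (y θ) := rfl
  -- expansion of `-s n / D` to second order in `s`, with exact remainder
  have hF : P.F θ (y θ) = -P.s * P.n₀ θ - P.s ^ 2 * (P.n₁ θ (y θ) - P.n₀ θ * (P.m₀ θ * (y θ)⁻¹)) -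
      P.s ^ 3 * (P.n₂ θ (y θ) - P.n₀ θ * (P.d₁ θ (y θ) + P.s * P.d₂ θ (y θ)) -
        (P.n₁ θ (y θ) + P.s * P.n₂ θ (y θ)) * P.d θ (y θ) +
        P.n θ (y θ) * P.d θ (y θ) ^ 2 * (P.D θ (y θ))⁻¹) := by
    have h1 : (P.D θ (y θ))⁻¹ =
        1 - P.s * P.d θ (y θ) + P.s ^ 2 * P.d θ (y θ) ^ 2 * (P.D θ (y θ))⁻¹ := by
      field_simp
      rw [hdef]; ring
    rw [F]
    nth_rw 1 [h1]
    have h2 : P.d θ (y θ) = P.m₀ θ * (y θ)⁻¹ + P.s * (P.d₁ θ (y θ) + P.s * P.d₂ θ (y θ)) := rfl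
    have h3 : P.n θ (y θ) = P.n₀ θ + P.s * (P.n₁ θ (y θ) + P.s * P.n₂ θ (y θ)) := rfl
    linear_combination (-P.s + P.s ^ 2 * P.d θ (y θ)) * h3 + P.s ^ 2 * P.n₀ θ * h2
  have hF' : P.F θ (y θ) = -P.s * (P.n θ (y θ) * (P.D θ (y θ))⁻¹) := by rw [F]; ring
  have hn₁ : P.n₁ θ (y θ) = P.κ * (P.b / 2) * Real.cos θ ^ 2 * y θ +
    P.b₃ * Real.cos θ ^ 3 * Real.sin θ * (y θ)⁻¹ := rfl
  have hsplit : P.F θ (y θ) + (P.s * P.n₀ θ + P.s ^ 2 *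
      (P.κ * (P.b / 2) * (Real.cos θ ^ 2 - 1 / 2) * y θ + P.α θ * P.F θ (y θ) +
        ((P.b₃ * Real.cos θ ^ 3 * Real.sin θ - P.n₀ θ * P.m₀ θ + P.κ * P.b / 4) * (y θ)⁻¹ +
          P.β θ * (-P.F θ (y θ) / y θ ^ 2)))) =
      (P.F θ (y θ) + P.s * P.n₀ θ + P.s ^ 2 *
        (P.κ * (P.b / 2) * (Real.cos θ ^ 2 - 1 / 2) * y θ +
        (P.b₃ * Real.cos θ ^ 3 * Real.sin θ - P.n₀ θ * P.m₀ θ + P.κ * P.b / 4) * (y θ)⁻¹)) +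
      P.s ^ 2 * (P.α θ - P.β θ * (y θ)⁻¹ ^ 2) * P.F θ (y θ) := by
    rw [inv_pow, div_eq_mul_inv]; ring
  refine hsplit.trans ?_
  nth_rw 2 [hF']
  rw [hF, hn₁, G, E, hn₁]
  ring

end HopfData

/-! ### Uniform estimates for the averaged equation -/

namespace HopfData

/-- The index set of all bounded data together with all angles. -/
def index (K s₀ : ℝ) : Set (HopfData × ℝ) := {i | i.1.BoundedBy K ∧ i.1.s ≤ s₀}

section UnifLip

variable {K s₀ : ℝ}

theorem inv_mem_of_mem_box {y : ℝ} (hy : y ∈ Icc (1 / 2 : ℝ) 2) : y⁻¹ ∈ Icc (1 / 2 : ℝ) 2 := by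
  have h0 : 0 < y := by linarith [hy.1]
  have := mul_inv_cancel₀ h0.ne'
  have h1 := inv_pos.2 h0
  constructor <;> nlinarith [hy.1, hy.2]

theorem arg_mem {P : HopfData} (h : P.BoundedBy K) (θ : ℝ) {y : ℝ} (hy : y ∈ Icc (1 / 2 : ℝ) 2) :
    P.s * Real.cos θ / y ∈ Icc (-2 : ℝ) 2 := by
  have h1 := inv_mem_of_mem_box hy
  rw [mem_Icc, ← abs_le, div_eq_mul_inv, abs_mul, abs_mul, abs_of_pos h.s_mem.1,
    abs_of_nonneg (by linarith [h1.1] : 0 ≤ y⁻¹)]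
  calc P.s * |Real.cos θ| * y⁻¹ ≤ 1 * 1 * 2 := by
        have : 0 ≤ y⁻¹ := by linarith [h1.1]
        gcongr
        · exact h.s_mem.2
        · exact Real.abs_cos_le_one θ
        · exact h1.2
    _ = 2 := by norm_num

theorem unifLip_κ : UnifLip (index K s₀) (Icc (1 / 2) 2) fun i _ => i.1.κ :=
  .of_const (C := K) fun i hi => by
    have h := hi.1.κ_mem
    have hK : 0 ≤ K := hi.1.K_pos.le
    rw [abs_of_nonneg ((inv_nonneg.2 hK).trans h.1)]
    exact h.2

theorem unifLip_b : UnifLip (index K s₀) (Icc (1 / 2) 2) fun i _ => i.1.b :=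
  .of_const (C := K) fun i hi => by
    have h := hi.1.b_mem
    have hK : 0 ≤ K := hi.1.K_pos.le
    rw [abs_of_nonneg ((inv_nonneg.2 hK).trans h.1)]
    exact h.2

theorem unifLip_b₃ : UnifLip (index K s₀) (Icc (1 / 2) 2) fun i _ => i.1.b₃ :=
  .of_const (C := K) fun _ hi => hi.1.b₃_le

theorem unifLip_s : UnifLip (index K s₀) (Icc (1 / 2) 2) fun i _ => i.1.s :=
  .of_const (C := 1) fun i hi => by rw [abs_of_pos hi.1.s_mem.1]; exact hi.1.s_mem.2

theorem unifLip_sin : UnifLip (index K s₀) (Icc (1 / 2) 2) fun i _ => Real.sin i.2 :=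
  .of_const (C := 1) fun _ _ => Real.abs_sin_le_one _

theorem unifLip_cos : UnifLip (index K s₀) (Icc (1 / 2) 2) fun i _ => Real.cos i.2 :=
  .of_const (C := 1) fun _ _ => Real.abs_cos_le_one _

theorem unifLip_num (c : ℝ) : UnifLip (index K s₀) (Icc (1 / 2) 2) fun _ _ => c :=
  .of_const (C := |c|) fun _ _ => le_rfl

theorem unifLip_id : UnifLip (index K s₀) (Icc (1 / 2) 2) fun _ y => y :=
  ⟨2, fun _ _ => ⟨fun y hy => by rw [abs_of_pos (by linarith [hy.1])]; exact hy.2,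
    fun y₁ _ y₂ _ => by linarith [abs_nonneg (y₁ - y₂)]⟩⟩

theorem unifLip_inv : UnifLip (index K s₀) (Icc (1 / 2) 2) fun _ y => y⁻¹ :=
  unifLip_id.inv (m := 1 / 2) (by norm_num) fun _ _ _ hy => hy.1

theorem unifLip_q : UnifLip (index K s₀) (Icc (1 / 2) 2) fun i y => i.1.q i.2 y := by
  obtain ⟨C, hC0, hC⟩ := (unifLip_s.mul unifLip_cos |>.mul unifLip_inv :
    UnifLip (index K s₀) (Icc (1 / 2) 2) fun i y => i.1.s * Real.cos i.2 * y⁻¹).exists_pos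
  refine ⟨max K (K * C), fun i hi => ⟨fun y hy => ?_, fun y₁ h₁ y₂ h₂ => ?_⟩⟩
  · exact (hi.1.Q_le _ (arg_mem hi.1 _ hy)).trans (le_max_left _ _)
  · have hK : 0 ≤ K := hi.1.K_pos.le
    refine (hi.1.Q_lip _ (arg_mem hi.1 _ h₁) _ (arg_mem hi.1 _ h₂)).trans ?_
    calc K * |i.1.s * Real.cos i.2 / y₁ - i.1.s * Real.cos i.2 / y₂|
        ≤ K * (C * |y₁ - y₂|) := by
          gcongr
          exact (hC i hi).2 y₁ h₁ y₂ h₂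
      _ = K * C * |y₁ - y₂| := by ring
      _ ≤ _ := by gcongr; exact le_max_right _ _

theorem unifLip_n₀ : UnifLip (index K s₀) (Icc (1 / 2) 2) fun i _ => i.1.n₀ i.2 :=
  (unifLip_κ.mul (unifLip_cos.pow 3)).add ((unifLip_b.mul (unifLip_cos.pow 2)).mul unifLip_sin)

theorem unifLip_m₀ : UnifLip (index K s₀) (Icc (1 / 2) 2) fun i _ => i.1.m₀ i.2 :=
  (unifLip_b.mul (unifLip_cos.pow 3)).sub ((unifLip_κ.mul (unifLip_cos.pow 2)).mul unifLip_sin)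

theorem unifLip_half : UnifLip (index K s₀) (Icc (1 / 2) 2) fun i _ => i.1.κ * (i.1.b / 2) :=
  unifLip_κ.mul (unifLip_b.mul (unifLip_num 2⁻¹))

theorem unifLip_n₁ : UnifLip (index K s₀) (Icc (1 / 2) 2) fun i y => i.1.n₁ i.2 y :=
  ((unifLip_half.mul (unifLip_cos.pow 2)).mul unifLip_id).add
    (((unifLip_b₃.mul (unifLip_cos.pow 3)).mul unifLip_sin).mul unifLip_inv)

theorem unifLip_n₂ : UnifLip (index K s₀) (Icc (1 / 2) 2) fun i y => i.1.n₂ i.2 y :=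
  ((unifLip_sin.mul (unifLip_cos.pow 4)).mul unifLip_q).mul (unifLip_inv.pow 2)

theorem unifLip_n : UnifLip (index K s₀) (Icc (1 / 2) 2) fun i y => i.1.n i.2 y :=
  unifLip_n₀.add (unifLip_s.mul (unifLip_n₁.add (unifLip_s.mul unifLip_n₂)))

theorem unifLip_d₁ : UnifLip (index K s₀) (Icc (1 / 2) 2) fun i y => i.1.d₁ i.2 y :=
  ((unifLip_b₃.mul (unifLip_cos.pow 4)).mul (unifLip_inv.pow 2)).sub
    ((unifLip_half.mul unifLip_cos).mul unifLip_sin)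

theorem unifLip_d₂ : UnifLip (index K s₀) (Icc (1 / 2) 2) fun i y => i.1.d₂ i.2 y :=
  ((unifLip_cos.pow 5).mul unifLip_q).mul (unifLip_inv.pow 3)

theorem unifLip_d : UnifLip (index K s₀) (Icc (1 / 2) 2) fun i y => i.1.d i.2 y :=
  (unifLip_m₀.mul unifLip_inv).add (unifLip_s.mul (unifLip_d₁.add (unifLip_s.mul unifLip_d₂)))

theorem unifLip_D : UnifLip (index K s₀) (Icc (1 / 2) 2) fun i y => i.1.D i.2 y :=
  (unifLip_num 1).add (unifLip_s.mul unifLip_d)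

theorem unifLip_a : UnifLip (index K s₀) (Icc (1 / 2) 2) fun i _ => i.1.a i.2 :=
  (unifLip_κ.mul (unifLip_sin.sub ((unifLip_sin.pow 3).mul (unifLip_num 3⁻¹)))).sub
    ((unifLip_b.mul (unifLip_cos.pow 3)).mul (unifLip_num 3⁻¹))

theorem unifLip_α : UnifLip (index K s₀) (Icc (1 / 2) 2) fun i _ => i.1.α i.2 :=
  unifLip_half.mul ((unifLip_sin.mul unifLip_cos).mul (unifLip_num 2⁻¹))

theorem unifLip_β : UnifLip (index K s₀) (Icc (1 / 2) 2) fun i _ => i.1.β i.2 :=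
  ((unifLip_b₃.neg.mul (unifLip_cos.pow 4)).mul (unifLip_num 4⁻¹)).sub
    (((unifLip_κ.mul unifLip_b).mul
      (((((unifLip_cos.pow 5).mul unifLip_sin).mul (unifLip_num 3⁻¹)).add
        (((unifLip_cos.pow 3).mul unifLip_sin).mul (unifLip_num 6⁻¹))).add
        ((unifLip_cos.mul unifLip_sin).mul (unifLip_num 4⁻¹)))).sub
      ((((unifLip_b.pow 2).sub (unifLip_κ.pow 2)).mul (unifLip_cos.pow 6)).mul (unifLip_num 6⁻¹)))

/-- The difference between the averaged coordinate and `y`, divided by `s`. -/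
theorem unifLip_M : UnifLip (index K s₀) (Icc (1 / 2) 2) fun i y =>
    i.1.a i.2 + i.1.s * (i.1.α i.2 * y + i.1.β i.2 * y⁻¹) :=
  unifLip_a.add (unifLip_s.mul ((unifLip_α.mul unifLip_id).add (unifLip_β.mul unifLip_inv)))

theorem unifLip_Dinv (hD : ∀ i ∈ index K s₀, ∀ y ∈ Icc (1 / 2 : ℝ) 2, 1 / 2 ≤ i.1.D i.2 y) :
    UnifLip (index K s₀) (Icc (1 / 2) 2) fun i y => (i.1.D i.2 y)⁻¹ :=
  unifLip_D.inv (by norm_num) hD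

theorem unifLip_F (hD : ∀ i ∈ index K s₀, ∀ y ∈ Icc (1 / 2 : ℝ) 2, 1 / 2 ≤ i.1.D i.2 y) :
    UnifLip (index K s₀) (Icc (1 / 2) 2) fun i y => i.1.F i.2 y :=
  (unifLip_s.neg.mul unifLip_n).mul (unifLip_Dinv hD)

theorem unifLip_E (hD : ∀ i ∈ index K s₀, ∀ y ∈ Icc (1 / 2 : ℝ) 2, 1 / 2 ≤ i.1.D i.2 y) :
    UnifLip (index K s₀) (Icc (1 / 2) 2) fun i y => i.1.E i.2 y :=
  (((unifLip_n₂.sub (unifLip_n₀.mul (unifLip_d₁.add (unifLip_s.mul unifLip_d₂)))).sub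
      ((unifLip_n₁.add (unifLip_s.mul unifLip_n₂)).mul unifLip_d)).add
      ((unifLip_n.mul (unifLip_d.pow 2)).mul (unifLip_Dinv hD))).neg.sub
    ((unifLip_n.mul (unifLip_Dinv hD)).mul (unifLip_α.sub (unifLip_β.mul (unifLip_inv.pow 2))))

end UnifLip

theorem continuousOn_D {P : HopfData} (hQ : Continuous P.Q) :
    ContinuousOn (fun v : ℝ × ℝ => P.D v.1 v.2) (univ ×ˢ Icc (1 / 2) 2) := by
  have h0 : ∀ v ∈ (univ ×ˢ Icc (1 / 2) 2 : Set (ℝ × ℝ)), v.2 ≠ 0 := fun v hv => by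
    have := hv.2.1; positivity
  have hinv : ContinuousOn (fun v : ℝ × ℝ => v.2⁻¹) (univ ×ˢ Icc (1 / 2) 2) :=
    continuousOn_snd.inv₀ h0
  unfold D d d₁ d₂ m₀ q
  simp only [div_eq_mul_inv _ (Prod.snd _)]
  fun_prop

theorem continuousOn_n {P : HopfData} (hQ : Continuous P.Q) :
    ContinuousOn (fun v : ℝ × ℝ => P.n v.1 v.2) (univ ×ˢ Icc (1 / 2) 2) := by
  have h0 : ∀ v ∈ (univ ×ˢ Icc (1 / 2) 2 : Set (ℝ × ℝ)), v.2 ≠ 0 := fun v hv => by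
    have := hv.2.1; positivity
  have hinv : ContinuousOn (fun v : ℝ × ℝ => v.2⁻¹) (univ ×ˢ Icc (1 / 2) 2) :=
    continuousOn_snd.inv₀ h0
  unfold n n₁ n₂ n₀ q
  simp only [div_eq_mul_inv _ (Prod.snd _)]
  fun_prop

theorem D_add_two_pi (P : HopfData) (θ y : ℝ) : P.D (θ + 2 * Real.pi) y = P.D θ y := by
  simp only [D, d, d₁, d₂, m₀, q, Real.cos_add_two_pi, Real.sin_add_two_pi]

theorem F_add_two_pi (P : HopfData) (θ y : ℝ) : P.F (θ + 2 * Real.pi) y = P.F θ y := by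
  simp only [F, D_add_two_pi, n, n₀, n₁, n₂, q, Real.cos_add_two_pi, Real.sin_add_two_pi]

theorem M_add_two_pi (P : HopfData) (θ y : ℝ) : P.M (θ + 2 * Real.pi) y = P.M θ y := by
  simp only [M, a, α, β, Real.cos_add_two_pi, Real.sin_add_two_pi]

/-- For small amplitude the angular velocity stays away from zero. -/
theorem exists_half_le_D (K : ℝ) : ∃ s₀ > 0, ∀ i ∈ index K s₀, ∀ y ∈ Icc (1 / 2 : ℝ) 2,
    1 / 2 ≤ i.1.D i.2 y := by
  obtain ⟨C, hC0, hC⟩ := (unifLip_d (K := K) (s₀ := 1)).exists_pos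
  refine ⟨min 1 (1 / (2 * C)), by positivity, fun i hi y hy => ?_⟩
  have h1 := (hC i ⟨hi.1, hi.2.trans (min_le_left _ _)⟩).1 y hy
  have h2 := hi.2.trans (min_le_right _ _)
  rw [le_div_iff₀ (by positivity)] at h2
  have hs := hi.1.s_mem.1
  have h3 := (abs_le.1 h1).1
  rw [D]
  nlinarith

/-- The contraction estimate: `W` is the difference of two averaged coordinates, `u` that of the
coordinates, `v` that of the averaged drifts and `e` that of the remainders. -/
theorem drift_contracts {s lam C u v W e : ℝ} (hs : 0 ≤ s) (hlam : 0 ≤ lam)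
    (hsC : s * C ≤ lam / 6) (hv : u ^ 2 / 2 ≤ W * v) (he : W * e ≤ 3 / 2 * C * u ^ 2)
    (hW : W ^ 2 ≤ 9 / 4 * u ^ 2) :
    W * (-(s ^ 2 * lam * v) + s ^ 3 * e) ≤ -(s ^ 2 * (lam / 9)) * W ^ 2 := by
  have h1 : s * (W * e) ≤ lam / 4 * u ^ 2 := by
    calc s * (W * e) ≤ s * (3 / 2 * C * u ^ 2) := by gcongr
      _ = 3 / 2 * (s * C) * u ^ 2 := by ring
      _ ≤ 3 / 2 * (lam / 6) * u ^ 2 := by gcongr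
      _ = _ := by ring
  have h2 := mul_le_mul_of_nonneg_left hv hlam
  have h3 := mul_le_mul_of_nonneg_left hW hlam
  have h4 : 0 ≤ lam * (W * v) - s * (W * e) - lam / 9 * W ^ 2 := by linarith
  have h5 := mul_nonneg (sq_nonneg s) h4
  linarith

/-- For small amplitude the averaged drift `-(s² κ b / 4) (y - y⁻¹)`, which is decreasing in `y` and
vanishes at `y = 1`, dominates the remainder: the equation is contracting. -/
theorem exists_isContractingODE (K : ℝ) : ∃ s₀ > 0, ∀ P : HopfData, P.BoundedBy K → P.s ≤ s₀ →
    (∀ θ, ∀ y ∈ Icc (1 / 2 : ℝ) 2, 1 / 2 ≤ P.D θ y) ∧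
    (∃ L : NNReal, ∀ θ, LipschitzOnWith L (fun y => (P.D θ y)⁻¹) (Icc (1 / 2) 2)) ∧
    (∃ C > 0, ∀ θ, ∀ y ∈ Icc (1 / 2 : ℝ) 2, P.D θ y ≤ C) ∧
    IsContractingODE P.F P.M P.G (1 / 2) 2 (3 / 4) (5 / 4) (P.s ^ 2 * (P.κ * P.b) / 36) := by
  obtain ⟨s₁, hs₁, hD⟩ := exists_half_le_D K
  obtain ⟨CM, hCM0, hCM⟩ := (unifLip_M (K := K) (s₀ := s₁)).exists_pos
  obtain ⟨CE, hCE0, hCE⟩ := (unifLip_E hD).exists_pos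
  obtain ⟨CF, hCF0, hCF⟩ := (unifLip_F hD).exists_pos
  obtain ⟨CI, hCI0, hCI⟩ := (unifLip_Dinv hD).exists_pos
  obtain ⟨CD, hCD0, hCD⟩ := (unifLip_D (K := K) (s₀ := s₁)).exists_pos
  refine ⟨min s₁ (min (1 / (16 * CM)) (1 / (24 * CE * max K 1 ^ 2))), by positivity,
    fun P hP hPs => ?_⟩
  have hs := hP.s_mem.1
  have hK := hP.K_pos
  have hmem : ∀ θ, (P, θ) ∈ index K s₁ := fun θ => ⟨hP, hPs.trans (min_le_left _ _)⟩
  have hsM : P.s * CM ≤ 1 / 16 := by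
    have := (hPs.trans (min_le_right _ _)).trans (min_le_left _ _)
    rw [le_div_iff₀ (by positivity)] at this
    linarith
  -- `lam` is the strength of the averaged drift
  set lam : ℝ := P.κ * P.b / 4 with hlam
  have hlamK : 1 / (4 * max K 1 ^ 2) ≤ lam := by
    have h1 := hP.κ_mem.1
    have h2 := hP.b_mem.1
    have h3 : (max K 1)⁻¹ ≤ K⁻¹ := inv_anti₀ hK (le_max_left _ _)
    have h4 : (max K 1)⁻¹ * (max K 1)⁻¹ ≤ P.κ * P.b :=
      mul_le_mul (h3.trans h1) (h3.trans h2) (by positivity)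
        ((inv_nonneg.2 hK.le).trans h1)
    rw [hlam]
    calc 1 / (4 * max K 1 ^ 2) = (max K 1)⁻¹ * (max K 1)⁻¹ / 4 := by field_simp
      _ ≤ _ := by linarith
  have hlam0 : 0 < lam := lt_of_lt_of_le (by positivity) hlamK
  have hsE : P.s * CE ≤ lam / 6 := by
    have h1 := (hPs.trans (min_le_right _ _)).trans (min_le_right _ _)
    rw [le_div_iff₀ (by positivity)] at h1
    refine le_trans ?_ (div_le_div_of_nonneg_right hlamK (by norm_num))
    rw [div_div, le_div_iff₀ (by positivity)]
    linarith
  have hDP : ∀ θ, ∀ y ∈ Icc (1 / 2 : ℝ) 2, 1 / 2 ≤ P.D θ y := fun θ => hD (P, θ) (hmem θ)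
  have hDne : ∀ v ∈ (univ ×ˢ Icc (1 / 2) 2 : Set (ℝ × ℝ)), P.D v.1 v.2 ≠ 0 := fun v hv => by
    have := hDP v.1 v.2 hv.2; positivity
  have hE : ∀ θ, ∀ y ∈ Icc (1 / 2 : ℝ) 2, |P.E θ y| ≤ CE := fun θ => (hCE _ (hmem θ)).1
  have hMy : ∀ θ, ∀ y ∈ Icc (1 / 2 : ℝ) 2, |P.M θ y - y| ≤ 1 / 16 := by
    intro θ y hy
    have h1 : P.M θ y - y = P.s * (P.a θ + P.s * (P.α θ * y + P.β θ * y⁻¹)) := by rw [M]; ring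
    rw [h1, abs_mul, abs_of_pos hs]
    exact (mul_le_mul_of_nonneg_left ((hCM _ (hmem θ)).1 y hy) hs.le).trans hsM
  have hnear : ∀ θ, ∀ y₁ ∈ Icc (1 / 2 : ℝ) 2, ∀ y₂ ∈ Icc (1 / 2 : ℝ) 2,
      |(P.M θ y₁ - P.M θ y₂) - (y₁ - y₂)| ≤ |y₁ - y₂| / 2 := by
    intro θ y₁ h₁ y₂ h₂
    have h1 : (P.M θ y₁ - P.M θ y₂) - (y₁ - y₂) =
        P.s * ((P.a θ + P.s * (P.α θ * y₁ + P.β θ * y₁⁻¹)) -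
          (P.a θ + P.s * (P.α θ * y₂ + P.β θ * y₂⁻¹))) := by rw [M, M]; ring
    rw [h1, abs_mul, abs_of_pos hs]
    refine (mul_le_mul_of_nonneg_left ((hCM _ (hmem θ)).2 y₁ h₁ y₂ h₂) hs.le).trans ?_
    rw [← mul_assoc]
    have := mul_le_mul_of_nonneg_right hsM (abs_nonneg (y₁ - y₂))
    linarith [abs_nonneg (y₁ - y₂)]
  refine ⟨hDP, ⟨⟨CI, hCI0.le⟩, fun θ => LipschitzOnWith.of_dist_le_mul
    fun y₁ h₁ y₂ h₂ => (hCI _ (hmem θ)).2 y₁ h₁ y₂ h₂⟩, ⟨CD, hCD0, fun θ y hy =>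
    (le_abs_self _).trans ((hCD _ (hmem θ)).1 y hy)⟩, ?_⟩
  refine
    { le := by norm_num
      lip := ⟨⟨CF, hCF0.le⟩, fun θ => LipschitzOnWith.of_dist_le_mul
        fun y₁ h₁ y₂ h₂ => (hCF _ (hmem θ)).2 y₁ h₁ y₂ h₂⟩
      cont := ?_
      bdd := ⟨⟨CF, hCF0.le⟩, fun θ y hy => (hCF _ (hmem θ)).1 y hy⟩
      periodic_field := P.F_add_two_pi
      periodic_coord := P.M_add_two_pi
      hasDerivAt_coord := ?_
      near_id := hnear
      c_pos := by
        have : 0 < P.κ * P.b := by rw [hlam] at hlam0; linarith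
        positivity
      contract := ?_
      inside := ?_
      at_lo := ?_
      at_hi := ?_
      nonempty := ?_ }
  · intro y hy
    have h1 : ContinuousOn (fun v : ℝ × ℝ => P.F v.1 v.2) (univ ×ˢ Icc (1 / 2) 2) :=
      (continuousOn_const.mul (continuousOn_n hP.continuous_Q)).mul
        ((continuousOn_D hP.continuous_Q).inv₀ hDne)
    exact h1.comp_continuous (f := fun θ => (θ, y)) (by fun_prop) fun θ => ⟨mem_univ _, hy⟩
  · intro y θ hy hd
    have h0 : y θ ≠ 0 := by have := hy.1; positivity
    exact hasDerivAt_M h0 (hDne (θ, y θ) ⟨mem_univ _, hy⟩) hd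
  · intro θ y₁ h₁ y₂ h₂
    have hy₁ : 0 < y₁ := by linarith [h₁.1]
    have hy₂ : 0 < y₂ := by linarith [h₂.1]
    set u := y₁ - y₂ with hu
    set W := P.M θ y₁ - P.M θ y₂ with hW
    have hn := hnear θ y₁ h₁ y₂ h₂
    have hEl : |P.E θ y₁ - P.E θ y₂| ≤ CE * |u| := (hCE _ (hmem θ)).2 y₁ h₁ y₂ h₂
    have hG : P.G θ y₁ - P.G θ y₂ = -(P.s ^ 2 * lam * (u * (1 + (y₁ * y₂)⁻¹))) +
        P.s ^ 3 * (P.E θ y₁ - P.E θ y₂) := by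
      rw [G, G, hu]; field_simp; ring
    have hWabs : |W| ≤ 3 / 2 * |u| := by
      have := abs_sub_abs_le_abs_sub W u
      linarith
    have hWu : u ^ 2 / 2 ≤ W * u := by
      have h3 : |(W - u) * u| ≤ u ^ 2 / 2 := by
        rw [abs_mul, ← sq_abs u]
        have := mul_le_mul_of_nonneg_right hn (abs_nonneg u)
        linarith
      have := (abs_le.1 h3).1
      linarith
    have hWu' : u ^ 2 / 2 ≤ W * (u * (1 + (y₁ * y₂)⁻¹)) := by
      have h4 : 0 ≤ W * u := le_trans (by positivity) hWu
      have h5 : 0 ≤ W * u * (y₁ * y₂)⁻¹ := mul_nonneg h4 (by positivity)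
      linarith
    have hWE : W * (P.E θ y₁ - P.E θ y₂) ≤ 3 / 2 * CE * u ^ 2 := by
      refine (le_abs_self _).trans ?_
      rw [abs_mul, ← sq_abs u]
      calc |W| * |P.E θ y₁ - P.E θ y₂| ≤ (3 / 2 * |u|) * (CE * |u|) := by gcongr
        _ = _ := by ring
    have hW2 : W ^ 2 ≤ 9 / 4 * u ^ 2 := by
      have := pow_le_pow_left₀ (abs_nonneg W) hWabs 2
      rw [mul_pow, sq_abs, sq_abs] at this
      linarith
    rw [hG]
    have hl : P.s ^ 2 * (P.κ * P.b) / 36 = P.s ^ 2 * (lam / 9) := by rw [hlam]; ring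
    rw [hl]
    exact drift_contracts hs.le hlam0.le hsE hWu' hWE hW2
  · intro θ y hy hM
    have h1 := abs_le.1 (hMy θ y hy)
    constructor <;> linarith [hM.1, hM.2]
  · intro θ y hy hM
    have h1 := abs_le.1 (hMy θ y hy)
    have h2 := (abs_le.1 (hE θ y hy)).1
    have hy0 : 0 < y := by linarith [hy.1]
    have h3 : y - y⁻¹ ≤ -(1 / 3) := by
      have h4 : (13 / 16 : ℝ)⁻¹ ≤ y⁻¹ := inv_anti₀ hy0 (by linarith)
      norm_num at h4
      linarith
    have h5 : P.G θ y = P.s ^ 2 * (-(lam * (y - y⁻¹)) + P.s * P.E θ y) := by rw [G]; ring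
    rw [h5]
    have h6 : -(lam / 6) ≤ P.s * P.E θ y := by
      have := mul_le_mul_of_nonneg_left h2 hs.le
      linarith
    have h7 : lam * (1 / 3) ≤ -(lam * (y - y⁻¹)) := by
      have := mul_le_mul_of_nonneg_left h3 hlam0.le
      linarith
    have : 0 < -(lam * (y - y⁻¹)) + P.s * P.E θ y := by linarith
    positivity
  · intro θ y hy hM
    have h1 := abs_le.1 (hMy θ y hy)
    have h2 := (abs_le.1 (hE θ y hy)).2
    have hy0 : 0 < y := by linarith [hy.1]
    have h3 : 1 / 3 ≤ y - y⁻¹ := by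
      have h4 : y⁻¹ ≤ (19 / 16 : ℝ)⁻¹ := inv_anti₀ (by norm_num) (by linarith)
      norm_num at h4
      linarith
    have h5 : P.G θ y = P.s ^ 2 * (-(lam * (y - y⁻¹)) + P.s * P.E θ y) := by rw [G]; ring
    rw [h5]
    have h6 : P.s * P.E θ y ≤ lam / 6 := (mul_le_mul_of_nonneg_left h2 hs.le).trans hsE
    have h7 : lam * (1 / 3) ≤ lam * (y - y⁻¹) := mul_le_mul_of_nonneg_left h3 hlam0.le
    exact mul_neg_of_pos_of_neg (by positivity) (by linarith)
  · have h1 := abs_le.1 (hMy 0 1 (by norm_num))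
    exact ⟨1, by norm_num, by constructor <;> linarith⟩

end HopfData

/-! ### The co-moving system in polar form -/

/-- The coefficients of the expansion of `∑_{n=1}^N (x + u) ^ n` in powers of `u`. -/
noncomputable def taylorCoeff (N k : ℕ) (x : ℝ) : ℝ :=
  ∑ n ∈ Finset.Icc 1 N, (n.choose k : ℝ) * x ^ (n - k)

theorem sum_add_pow (N : ℕ) (x u : ℝ) :
    ∑ n ∈ Finset.Icc 1 N, (x + u) ^ n = ∑ k ∈ Finset.range (N + 1), taylorCoeff N k x * u ^ k := by
  simp only [taylorCoeff, Finset.sum_mul]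
  rw [Finset.sum_comm]
  refine Finset.sum_congr rfl fun n hn => ?_
  have hn' : n + 1 ≤ N + 1 := Nat.succ_le_succ (Finset.mem_Icc.1 hn).2
  rw [add_comm x u, add_pow, ← Finset.sum_subset (Finset.range_mono hn')]
  · exact Finset.sum_congr rfl fun k _ => by ring
  · intro k _ hk
    rw [Finset.mem_range, not_lt] at hk
    rw [Nat.choose_eq_zero_of_lt (by omega)]
    simp

theorem sum_add_pow_sub {N : ℕ} (hN : 5 ≤ N) (x u : ℝ) :
    ∑ n ∈ Finset.Icc 1 N, (x + u) ^ n - ∑ n ∈ Finset.Icc 1 N, x ^ n =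
      taylorCoeff N 1 x * u + taylorCoeff N 2 x * u ^ 2 + taylorCoeff N 3 x * u ^ 3 +
        u ^ 4 * ∑ k ∈ Finset.range (N - 3), taylorCoeff N (k + 4) x * u ^ k := by
  obtain ⟨m, rfl⟩ := Nat.exists_eq_add_of_le hN
  have h0 : taylorCoeff (5 + m) 0 x = ∑ n ∈ Finset.Icc 1 (5 + m), x ^ n := by
    simp [taylorCoeff]
  rw [sum_add_pow, ← h0, show 5 + m + 1 = (m + 2) + 1 + 1 + 1 + 1 by ring,
    Finset.sum_range_succ', Finset.sum_range_succ', Finset.sum_range_succ',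
    Finset.sum_range_succ', show 5 + m - 3 = m + 2 by omega, Finset.mul_sum]
  have h1 : ∀ k ∈ Finset.range (m + 2), taylorCoeff (5 + m) (k + 1 + 1 + 1 + 1) x *
      u ^ (k + 1 + 1 + 1 + 1) = u ^ 4 * (taylorCoeff (5 + m) (k + 4) x * u ^ k) := by
    intro k _
    rw [show k + 1 + 1 + 1 + 1 = k + 4 by ring]; ring
  rw [Finset.sum_congr rfl h1]
  norm_num
  ring

theorem taylorCoeff_nonneg (N k : ℕ) {x : ℝ} (hx : 0 ≤ x) : 0 ≤ taylorCoeff N k x :=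
  Finset.sum_nonneg fun _ _ => by positivity

theorem taylorCoeff_le (N k : ℕ) {x : ℝ} (hx : x ∈ Icc (0 : ℝ) 1) :
    taylorCoeff N k x ≤ taylorCoeff N k 1 := by
  refine Finset.sum_le_sum fun n _ => ?_
  rw [one_pow]
  gcongr
  exact pow_le_one₀ hx.1 hx.2

theorem one_le_taylorCoeff {N k : ℕ} (hk : 1 ≤ k) (hkN : k ≤ N) {x : ℝ} (hx : 0 ≤ x) :
    1 ≤ taylorCoeff N k x := by
  have := Finset.single_le_sum (f := fun n => (n.choose k : ℝ) * x ^ (n - k))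
    (fun n _ => by positivity) (Finset.mem_Icc.2 ⟨hk, hkN⟩)
  simpa [taylorCoeff] using this

/-- The coefficients of the co-moving system at the equilibrium `(x, -x (x - 1))`. The scale `s` is
chosen such that the trace parameter is `2 x - 1 = s ^ 2 * (b / 2)`, which puts the
limit cycle near the inverse radius `y = 1`. -/
noncomputable def hopfData (N : ℕ) (ε x : ℝ) : HopfData where
  κ := (√(ε * taylorCoeff N 1 x))⁻¹
  b := taylorCoeff N 2 x / taylorCoeff N 1 x
  b₃ := taylorCoeff N 3 x / taylorCoeff N 1 x
  s := √(2 * (2 * x - 1) / (taylorCoeff N 2 x / taylorCoeff N 1 x))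
  Q := fun u => (∑ k ∈ Finset.range (N - 3), taylorCoeff N (k + 4) x * u ^ k) / taylorCoeff N 1 x

section

variable {N : ℕ} {ε : ℝ}

theorem hopfData_s_sq (hN : 5 ≤ N) {x : ℝ} (hx : x ∈ Ioc (1 / 2 : ℝ) 1) :
    2 * x - 1 = (hopfData N ε x).s ^ 2 * ((hopfData N ε x).b / 2) := by
  have h1 := one_le_taylorCoeff (N := N) (k := 1) (x := x) le_rfl (by omega) (by linarith [hx.1])
  have h2 := one_le_taylorCoeff (N := N) (k := 2) (x := x) (by norm_num) (by omega)
    (by linarith [hx.1])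
  have h3 : 0 ≤ 2 * x - 1 := by linarith [hx.1]
  simp only [hopfData]
  rw [Real.sq_sqrt (by positivity)]
  field_simp

/-- The amplitude scale is positive and tends to zero with `2 x - 1`. -/
theorem hopfData_s_mem (hN : 5 ≤ N) {x : ℝ} (hx : x ∈ Ioc (1 / 2 : ℝ) 1) :
    (hopfData N ε x).s ∈ Ioc 0 √(2 * (2 * x - 1) * taylorCoeff N 1 1) := by
  have h1 := one_le_taylorCoeff (N := N) (k := 1) (x := x) le_rfl (by omega) (by linarith [hx.1])
  have h2 := one_le_taylorCoeff (N := N) (k := 2) (x := x) (by norm_num) (by omega)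
    (by linarith [hx.1])
  have h3 : 0 < 2 * x - 1 := by linarith [hx.1]
  have h4 := taylorCoeff_le N 1 (x := x) ⟨by linarith [hx.1], hx.2⟩
  refine ⟨Real.sqrt_pos.2 (by positivity), Real.sqrt_le_sqrt ?_⟩
  rw [div_div_eq_mul_div]
  calc 2 * (2 * x - 1) * taylorCoeff N 1 x / taylorCoeff N 2 x
      ≤ 2 * (2 * x - 1) * taylorCoeff N 1 x := div_le_self (by positivity) h2
    _ ≤ _ := by gcongr

theorem exists_hopfData_boundedBy (hN : 5 ≤ N) (hε : 0 < ε) : ∃ K, ∀ x ∈ Ioc (1 / 2 : ℝ) 1,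
    (hopfData N ε x).s ≤ 1 → (hopfData N ε x).BoundedBy K := by
  set c : ℕ → ℝ := fun k => taylorCoeff N k 1 with hc
  have hcc1 : 1 ≤ c 1 := one_le_taylorCoeff le_rfl (by omega) zero_le_one
  set R₀ := ∑ k ∈ Finset.range (N - 3), c (k + 4) * 2 ^ k with hR₀
  set R₁ := ∑ k ∈ Finset.range (N - 3), c (k + 4) * (k * 2 ^ (k - 1)) with hR₁
  obtain ⟨K, k1, k2, k3, k4, k5, k6, k7, k8⟩ : ∃ K : ℝ, (√ε)⁻¹ ≤ K ∧ √(ε * c 1) ≤ K ∧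
      c 2 ≤ K ∧ c 1 ≤ K ∧ c 3 ≤ K ∧ R₀ ≤ K ∧ R₁ ≤ K ∧ 1 ≤ K :=
    ((eventually_ge_atTop _).and ((eventually_ge_atTop _).and ((eventually_ge_atTop _).and
      ((eventually_ge_atTop _).and ((eventually_ge_atTop _).and ((eventually_ge_atTop _).and
      ((eventually_ge_atTop _).and (eventually_ge_atTop _)))))))).exists
  have hK : 0 < K := by linarith
  refine ⟨K, fun x hx hs => ?_⟩
  have hx01 : x ∈ Icc (0 : ℝ) 1 := ⟨by linarith [hx.1], hx.2⟩
  have h1 : 1 ≤ taylorCoeff N 1 x := one_le_taylorCoeff le_rfl (by omega) hx01.1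
  have h2 : 1 ≤ taylorCoeff N 2 x := one_le_taylorCoeff (by norm_num) (by omega) hx01.1
  have hle : ∀ k, taylorCoeff N k x ≤ c k := fun k => taylorCoeff_le N k hx01
  have hnn : ∀ k, 0 ≤ taylorCoeff N k x := fun k => taylorCoeff_nonneg N k hx01.1
  have hQ : ∀ {v B : ℝ}, |v| ≤ B → B ≤ K → |v / taylorCoeff N 1 x| ≤ K := fun {v B} hv hB => by
    rw [abs_div, abs_of_pos (by linarith : 0 < taylorCoeff N 1 x)]
    exact (div_le_self (abs_nonneg _) h1).trans (hv.trans hB)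
  refine
    { K_pos := hK
      κ_mem := ⟨?_, ?_⟩
      b_mem := ⟨?_, ?_⟩
      b₃_le := hQ (by rw [abs_of_nonneg (hnn 3)]; exact hle 3) k5
      s_mem := ⟨(hopfData_s_mem hN hx).1, hs⟩
      continuous_Q := ?_
      Q_le := fun u hu => ?_
      Q_lip := fun u hu v hv => ?_ }
  · refine inv_anti₀ (Real.sqrt_pos.2 (by positivity)) ((Real.sqrt_le_sqrt ?_).trans k2)
    exact mul_le_mul_of_nonneg_left (hle 1) hε.le
  · refine (inv_anti₀ (Real.sqrt_pos.2 hε) (Real.sqrt_le_sqrt ?_)).trans k1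
    exact le_mul_of_one_le_right hε.le h1
  · simp only [hopfData]
    calc K⁻¹ ≤ (taylorCoeff N 1 x)⁻¹ := inv_anti₀ (by linarith) ((hle 1).trans k4)
      _ ≤ _ := by rw [← one_div]; gcongr
  · exact (div_le_self (hnn 2) h1).trans ((hle 2).trans k3)
  · simp only [hopfData]
    fun_prop
  · refine hQ (B := R₀) ((Finset.abs_sum_le_sum_abs _ _).trans (Finset.sum_le_sum fun k _ => ?_)) k6
    rw [abs_mul, abs_of_nonneg (hnn _), abs_pow]
    have hu' : |u| ≤ 2 := abs_le.2 hu
    have h3 := hle (k + 4)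
    have h4 := (hnn (k + 4)).trans h3
    gcongr
  · simp only [hopfData]
    rw [← sub_div, ← Finset.sum_sub_distrib, abs_div,
      abs_of_pos (by linarith : 0 < taylorCoeff N 1 x)]
    refine (div_le_self (abs_nonneg _) h1).trans ?_
    calc |∑ k ∈ Finset.range (N - 3),
          (taylorCoeff N (k + 4) x * u ^ k - taylorCoeff N (k + 4) x * v ^ k)|
        ≤ ∑ k ∈ Finset.range (N - 3), c (k + 4) * (k * 2 ^ (k - 1)) * |u - v| := by
          refine (Finset.abs_sum_le_sum_abs _ _).trans (Finset.sum_le_sum fun k _ => ?_)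
          rw [← mul_sub, abs_mul, abs_of_nonneg (hnn _), mul_assoc]
          have h5 : |u ^ k - v ^ k| ≤ k * 2 ^ (k - 1) * |u - v| := by
            refine (abs_pow_sub_pow_le u v k).trans ?_
            rw [mul_comm |u - v|, mul_right_comm]
            have : max |u| |v| ≤ 2 := max_le (abs_le.2 hu) (abs_le.2 hv)
            gcongr
          exact mul_le_mul (hle _) h5 (abs_nonneg _) ((hnn _).trans (hle _))
      _ = R₁ * |u - v| := by rw [hR₁, Finset.sum_mul]
      _ ≤ _ := by gcongr

end

namespace HopfData

/-- The rescaled vector field in Cartesian coordinates, recovered from its polar form. -/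
theorem polar_identities (P : HopfData) (θ : ℝ) {y : ℝ} (hy : y ≠ 0) :
    -Real.sin θ * y⁻¹ * P.D θ y + P.s * Real.cos θ * y⁻¹ ^ 2 * P.n θ y =
      -Real.sin θ * y⁻¹ + P.s * (P.κ * (Real.cos θ ^ 2 * y⁻¹ ^ 2 +
        P.s * (P.b / 2) * Real.cos θ * y⁻¹)) ∧
    Real.cos θ * y⁻¹ * P.D θ y + P.s * Real.sin θ * y⁻¹ ^ 2 * P.n θ y =
      Real.cos θ * y⁻¹ + P.s * (P.b * Real.cos θ ^ 2 * y⁻¹ ^ 2 +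
        P.s * P.b₃ * Real.cos θ ^ 3 * y⁻¹ ^ 3 + P.s ^ 2 * Real.cos θ ^ 4 * y⁻¹ ^ 4 * P.q θ y) := by
  set f := P.κ * (Real.cos θ ^ 2 * y⁻¹ ^ 2 + P.s * (P.b / 2) * Real.cos θ * y⁻¹) with hf
  set h := P.b * Real.cos θ ^ 2 * y⁻¹ ^ 2 + P.s * P.b₃ * Real.cos θ ^ 3 * y⁻¹ ^ 3 +
    P.s ^ 2 * Real.cos θ ^ 4 * y⁻¹ ^ 4 * P.q θ y with hh
  have hyz : y * y⁻¹ = 1 := mul_inv_cancel₀ hy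
  have hn : y⁻¹ ^ 2 * P.n θ y = Real.cos θ * f + Real.sin θ * h := by
    simp only [n, n₀, n₁, n₂, hf, hh]
    linear_combination (P.s * P.κ * (P.b / 2) * Real.cos θ ^ 2 * y⁻¹) * hyz
  have hD : y⁻¹ * P.D θ y = y⁻¹ + P.s * (Real.cos θ * h - Real.sin θ * f) := by
    simp only [D, d, m₀, d₁, d₂, hf, hh]
    ring
  have hsc := Real.sin_sq_add_cos_sq θ
  constructor
  · linear_combination (-Real.sin θ) * hD + (P.s * Real.cos θ) * hn + P.s * f * hsc
  · linear_combination Real.cos θ * hD + (P.s * Real.sin θ) * hn + P.s * h * hsc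

end HopfData

/-! ### The limit cycle of the co-moving system -/

/-- Near the equilibrium `(x, -x (x - 1))` the co-moving system has the polar form given by
`hopfData N ε x`; time is rescaled by the frequency `√(ε c) / ε`, `c = taylorCoeff N 1 x`. -/
theorem hasDerivAt_polarPoint_comoving {N : ℕ} (hN : 5 ≤ N) {ε : ℝ} (hε : 0 < ε) {x : ℝ}
    (hx : x ∈ Ioc (1 / 2 : ℝ) 1) {ϑ y : ℝ → ℝ} {t : ℝ} (hy0 : y t ≠ 0)
    (hD : (hopfData N ε x).D (ϑ t) (y t) ≠ 0)
    (hϑ : HasDerivAt ϑ (√(ε * taylorCoeff N 1 x) / ε * (hopfData N ε x).D (ϑ t) (y t)) t)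
    (hy : HasDerivAt y ((hopfData N ε x).F (ϑ t) (y t) *
      (√(ε * taylorCoeff N 1 x) / ε * (hopfData N ε x).D (ϑ t) (y t))) t) :
    HasDerivAt (fun τ => polarPoint (x, -(x * (x - 1))) (hopfData N ε x).s
        ((hopfData N ε x).s * √(ε * taylorCoeff N 1 x)) (ϑ τ) (y τ))
      (comovingField N ε (∑ n ∈ Finset.Icc 1 N, x ^ n) (polarPoint (x, -(x * (x - 1)))
        (hopfData N ε x).s ((hopfData N ε x).s * √(ε * taylorCoeff N 1 x)) (ϑ t) (y t))) t := by
  set P := hopfData N ε x with hP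
  set k := √(ε * taylorCoeff N 1 x) with hk
  have hc1 : 1 ≤ taylorCoeff N 1 x := one_le_taylorCoeff le_rfl (by omega) (by linarith [hx.1])
  have hkpos : 0 < k := Real.sqrt_pos.2 (by positivity)
  have hk2 : k ^ 2 = ε * taylorCoeff N 1 x := Real.sq_sqrt (by positivity)
  have hκ : P.κ * k = 1 := inv_mul_cancel₀ hkpos.ne'
  have hb : taylorCoeff N 2 x = P.b * taylorCoeff N 1 x := by
    rw [hP]; simp only [hopfData]; field_simp
  have hb₃ : taylorCoeff N 3 x = P.b₃ * taylorCoeff N 1 x := by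
    rw [hP]; simp only [hopfData]; field_simp
  have hμ := hopfData_s_sq (ε := ε) hN hx
  rw [← hP] at hμ
  set z := (y t)⁻¹ with hz
  have hq : ∑ j ∈ Finset.range (N - 3), taylorCoeff N (j + 4) x * (P.s * Real.cos (ϑ t) / y t) ^ j =
      P.q (ϑ t) (y t) * taylorCoeff N 1 x := by
    simp only [HopfData.q]
    rw [hP]; simp only [hopfData]; field_simp
  have hyt : P.F (ϑ t) (y t) * (k / ε * P.D (ϑ t) (y t)) = -(k / ε) * P.s * P.n (ϑ t) (y t) := by
    rw [HopfData.F]; field_simp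
  rw [hyt] at hy
  obtain ⟨h1, h2⟩ := P.polar_identities (ϑ t) hy0
  rw [← hz] at h1 h2
  have hd1 := ((hϑ.cos.const_mul P.s).div hy hy0).const_add x
  have hd2 := ((hϑ.sin.const_mul (P.s * k)).div hy hy0).const_sub (-(x * (x - 1)))
  refine (hd1.prodMk hd2).congr_deriv ?_
  have hdiv : ∀ u : ℝ, u / y t = u * z := fun u => div_eq_mul_inv _ _
  have hdiv2 : ∀ u : ℝ, u / y t ^ 2 = u * z ^ 2 := fun u => by
    rw [div_eq_mul_inv, hz, inv_pow]
  have hyz : y t * z = 1 := mul_inv_cancel₀ hy0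
  have hexp := sum_add_pow_sub hN x (P.s * Real.cos (ϑ t) / y t)
  rw [hq] at hexp
  simp only [comovingField, polarPoint]
  ext
  · simp only
    rw [eq_div_iff hε.ne', hdiv2, hdiv, hdiv]
    have hεε : k / ε * ε = k := div_mul_cancel₀ _ hε.ne'
    linear_combination (P.s * k) * h1 +
      (P.s ^ 2 * (Real.cos (ϑ t) ^ 2 * z ^ 2 + P.s * (P.b / 2) * Real.cos (ϑ t) * z)) * hκ -
      (P.s * Real.cos (ϑ t) * z) * hμ +
      (-P.s * Real.sin (ϑ t) * P.D (ϑ t) (y t) * z +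
        P.s ^ 2 * Real.cos (ϑ t) * P.n (ϑ t) (y t) * z ^ 2) * hεε +
      (-P.s * Real.sin (ϑ t) * (k / ε * P.D (ϑ t) (y t)) * z * ε) * hyz
  · simp only
    have hkε : k * (k / ε) = taylorCoeff N 1 x := by
      rw [mul_div_assoc', ← sq, hk2, mul_div_cancel_left₀ _ hε.ne']
    rw [hdiv] at hexp
    rw [hdiv2, hdiv]
    rw [hb, hb₃] at hexp
    linear_combination hexp - (taylorCoeff N 1 x * P.s) * h2 -
      (P.s * (Real.cos (ϑ t) * z * P.D (ϑ t) (y t) +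
        P.s * Real.sin (ϑ t) * z ^ 2 * P.n (ϑ t) (y t))) * hkε -
      (P.s * k * Real.cos (ϑ t) * (k / ε * P.D (ϑ t) (y t)) * z) * hyz

theorem comovingField_equilibrium (N : ℕ) (ε x : ℝ) :
    comovingField N ε (∑ n ∈ Finset.Icc 1 N, x ^ n) (x, -(x * (x - 1))) = 0 := by
  simp [comovingField]

/-- For `x` slightly above `1/2`, the co-moving system with `r = ∑ x ^ n` is in contracting polar
form around its equilibrium. -/
theorem exists_isPolarFlow_comoving {N : ℕ} (hN : 5 ≤ N) {ε : ℝ} (hε : 0 < ε) :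
    ∃ x₁ ∈ Ioc (1 / 2 : ℝ) 1, ∀ x ∈ Ioc (1 / 2) x₁, ∃ p M G : ℝ → ℝ → ℝ, ∃ c,
      IsPolarFlow (hopfData N ε x).F p M G (1 / 2) 2 (3 / 4) (5 / 4) c (x, -(x * (x - 1)))
        (hopfData N ε x).s ((hopfData N ε x).s * √(ε * taylorCoeff N 1 x))
        (comovingField N ε (∑ n ∈ Finset.Icc 1 N, x ^ n)) := by
  obtain ⟨K, hK⟩ := exists_hopfData_boundedBy hN hε
  obtain ⟨s₀, hs₀, hcontr⟩ := HopfData.exists_isContractingODE K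
  have hlim : Tendsto (fun x => √(2 * (2 * x - 1) * taylorCoeff N 1 1)) (𝓝 (1 / 2)) (𝓝 0) := by
    have : Continuous fun x => √(2 * (2 * x - 1) * taylorCoeff N 1 1) := by fun_prop
    simpa using this.tendsto (1 / 2)
  obtain ⟨ρ, hρ, hball⟩ := Metric.eventually_nhds_iff.1
    (hlim.eventually (gt_mem_nhds (lt_min hs₀ one_pos)))
  refine ⟨min 1 (1 / 2 + ρ / 2), ⟨lt_min (by norm_num) (by linarith), min_le_left _ _⟩,
    fun x hx => ?_⟩
  have hx1 : x ∈ Ioc (1 / 2 : ℝ) 1 := ⟨hx.1, hx.2.trans (min_le_left _ _)⟩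
  have hsmall := hball (y := x) (by
    have := hx.2.trans (min_le_right _ _)
    rw [Real.dist_eq, abs_of_pos (by linarith [hx.1])]
    linarith)
  have hs := hopfData_s_mem (ε := ε) hN hx1
  have hs' := hs.2.trans hsmall.le
  set P := hopfData N ε x with hP
  have hPK : P.BoundedBy K := hK x hx1 (hs'.trans (min_le_right _ _))
  obtain ⟨hD, ⟨L, hL⟩, ⟨C, hC0, hC⟩, hode⟩ := hcontr P hPK (hs'.trans (min_le_left _ _))
  have hc1 : 1 ≤ taylorCoeff N 1 x := one_le_taylorCoeff le_rfl (by omega) (by linarith [hx1.1])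
  set k := √(ε * taylorCoeff N 1 x) with hk
  have hkpos : 0 < k := Real.sqrt_pos.2 (by positivity)
  have hDpos : ∀ θ, ∀ y ∈ Icc (1 / 2 : ℝ) 2, 0 < P.D θ y := fun θ y hy => by
    linarith [hD θ y hy]
  refine ⟨fun θ y => (k / ε)⁻¹ * (P.D θ y)⁻¹, P.M, P.G, _,
    { toIsContractingODE := hode
      a_pos := by norm_num
      A_pos := hs.1
      B_pos := mul_pos hs.1 hkpos
      slowness_cont := ?_
      slowness_pos := ⟨(k / ε)⁻¹ * C⁻¹, by positivity, fun θ y hy => ?_⟩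
      slowness_periodic := fun θ y => by rw [P.D_add_two_pi]
      slowness_lip := ⟨Real.toNNReal (k / ε)⁻¹ * L, fun θ => LipschitzOnWith.of_dist_le_mul
        fun y₁ h₁ y₂ h₂ => ?_⟩
      field := fun ϑ y t hy hϑ hyd => ?_ }⟩
  · exact continuousOn_const.mul ((HopfData.continuousOn_D hPK.continuous_Q).inv₀
      fun v hv => (hDpos v.1 v.2 hv.2).ne')
  · have := inv_anti₀ (hDpos θ y hy) (hC θ y hy)
    gcongr
  · have := (hL θ).dist_le_mul y₁ h₁ y₂ h₂
    rw [Real.dist_eq] at this ⊢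
    rw [← mul_sub, abs_mul, abs_of_pos (by positivity : 0 < (k / ε)⁻¹), NNReal.coe_mul,
      Real.coe_toNNReal _ (by positivity), mul_assoc]
    exact mul_le_mul_of_nonneg_left this (by positivity)
  · rw [mul_inv, inv_inv, inv_inv] at hϑ hyd
    have hy0 : y t ≠ 0 := by have := hy.1; positivity
    exact hasDerivAt_polarPoint_comoving hN hε hx1 hy0 (hDpos _ _ hy).ne' hϑ hyd

/-- The cycle at the rate `r = ∑ x ^ n`, with a bound on its size that tends to zero as `x` tends
to `1/2`. -/
theorem exists_limitCycle_comoving {N : ℕ} (hN : 5 ≤ N) {ε : ℝ} (hε : 0 < ε) :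
    ∃ x₁ ∈ Ioc (1 / 2 : ℝ) 1, ∀ x ∈ Ioc (1 / 2) x₁, ∃ (γ : ℝ → ℝ × ℝ) (T : ℝ),
      IsPeriodicSolution (comovingField N ε (∑ n ∈ Finset.Icc 1 N, x ^ n)) γ T ∧
      WindsOnceClockwise γ T (x, -(x * (x - 1))) ∧
      HasAsymptoticPhase (comovingField N ε (∑ n ∈ Finset.Icc 1 N, x ^ n)) γ ∧
      ∀ t, dist (γ t) (x, -(x * (x - 1))) ≤ 2 * √(2 * (2 * x - 1) * taylorCoeff N 1 1) *
        max 1 √(ε * taylorCoeff N 1 1) := by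
  obtain ⟨x₁, hx₁, H⟩ := exists_isPolarFlow_comoving hN hε
  refine ⟨x₁, hx₁, fun x hx => ?_⟩
  obtain ⟨p, M, G, c, hflow⟩ := H x hx
  obtain ⟨γ, T, hγ, hwind, hpol, hphase⟩ := hflow.exists_attracting_cycle
  refine ⟨γ, T, hγ, hwind, hphase, fun t => ?_⟩
  have hx1 : x ∈ Ioc (1 / 2 : ℝ) 1 := ⟨hx.1, hx.2.trans hx₁.2⟩
  obtain ⟨θ, y, hy, hγt⟩ := hpol t
  have hs := hopfData_s_mem (ε := ε) hN hx1
  set s := (hopfData N ε x).s with hsdef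
  set m := max 1 √(ε * taylorCoeff N 1 1) with hm
  have hk : √(ε * taylorCoeff N 1 x) ≤ m := by
    refine (Real.sqrt_le_sqrt ?_).trans (le_max_right _ _)
    exact mul_le_mul_of_nonneg_left (taylorCoeff_le N 1 ⟨by linarith [hx1.1], hx1.2⟩) hε.le
  have hm1 : 1 ≤ m := le_max_left _ _
  have hyinv := HopfData.inv_mem_of_mem_box hy
  have hbound : ∀ A c : ℝ, 0 ≤ A → A ≤ s * m → |c| ≤ 1 →
      |A * c / y| ≤ 2 * √(2 * (2 * x - 1) * taylorCoeff N 1 1) * m := by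
    intro A c hA hAs hc
    have h0 : 0 ≤ y⁻¹ := by linarith [hyinv.1]
    have hs0 := hs.1.le
    rw [div_eq_mul_inv, abs_mul, abs_mul, abs_of_nonneg hA, abs_of_nonneg h0]
    calc A * |c| * y⁻¹ ≤ (s * m) * 1 * 2 := by
          gcongr
          · exact hyinv.2
      _ = 2 * s * m := by ring
      _ ≤ _ := by
          have := hs.2
          gcongr
  rw [hγt, Prod.dist_eq]
  refine max_le ?_ ?_
  · rw [Real.dist_eq]
    simp only [polarPoint, add_sub_cancel_left]
    exact hbound _ _ hs.1.le (le_mul_of_one_le_right hs.1.le hm1) (Real.abs_cos_le_one θ)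
  · rw [Real.dist_eq]
    simp only [polarPoint, sub_sub_cancel_left, abs_neg]
    exact hbound _ _ (mul_nonneg hs.1.le (Real.sqrt_nonneg _))
      (mul_le_mul_of_nonneg_left hk hs.1.le) (Real.abs_sin_le_one θ)

theorem strictMonoOn_sum_pow {N : ℕ} (hN : 1 ≤ N) :
    StrictMonoOn (fun x : ℝ => ∑ n ∈ Finset.Icc 1 N, x ^ n) (Ici 0) := by
  intro x hx y _ hxy
  exact Finset.sum_lt_sum_of_nonempty (Finset.nonempty_Icc.2 hN) fun n hn =>
    pow_lt_pow_left₀ hxy hx (by have := (Finset.mem_Icc.1 hn).1; omega)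

theorem mainTheorem2 (N : ℕ) (hN : Odd N) (hN5 : 5 ≤ N) (ε : ℝ) (hε : 0 < ε) :
    ∃ δ > 0, ∃ (γ : ℝ → ℝ → ℝ × ℝ) (T : ℝ → ℝ),
      (∀ r ∈ Ioo (criticalRate N) (criticalRate N + δ),
        -- an asymptotically stable limit cycle of the co-moving system
        IsLimitCycle (comovingField N ε r) (γ r) (T r) ∧
        IsAsymptoticallyStableOrbit (comovingField N ε r) (range (γ r)) ∧
        -- it winds around an equilibrium
        (∃ e, comovingField N ε r e = 0 ∧ WindsOnceClockwise (γ r) (T r) e) ∧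
        -- the spiraling curve is itself a trajectory of the forced system
        IsIntegralCurve (spiralCurve r (γ r)) (fun _ => forcedField N ε r) ∧
        -- trajectories of the forced system with `lam = r t` follow the spiraling curve
        ∃ d > 0, ∀ (t₀ : ℝ) (q₀ : ℝ × ℝ × ℝ), q₀.2.2 = r * t₀ →
          Metric.infDist (toComoving q₀) (range (γ r)) < d →
          (∃ q : ℝ → ℝ × ℝ × ℝ, q t₀ = q₀ ∧
            IsIntegralCurveOn q (fun _ => forcedField N ε r) (Ici t₀)) ∧
          ∀ q : ℝ → ℝ × ℝ × ℝ, q t₀ = q₀ →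
            IsIntegralCurveOn q (fun _ => forcedField N ε r) (Ici t₀) →
            ∃ θ : ℝ, Tendsto
              (fun t => dist (q t) (spiralCurve r (fun s => γ r (s + θ)) t)) atTop (𝓝 0)) ∧
      -- the limit cycle is born at the equilibrium of the critical system
      ∀ η > 0, ∀ᶠ r in 𝓝[>] criticalRate N, ∀ t, dist (γ r t) (1 / 2, 1 / 4) < η := by
  set R : ℝ → ℝ := fun x => ∑ n ∈ Finset.Icc 1 N, x ^ n with hR
  have hRc : Continuous R := by simp only [hR]; fun_prop
  have hmono : StrictMonoOn R (Ici 0) := strictMonoOn_sum_pow (by omega)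
  have hR0 : criticalRate N = R (1 / 2) := rfl
  obtain ⟨x₁, hx₁, H⟩ := exists_limitCycle_comoving hN5 hε
  have hx₁0 : (0 : ℝ) ≤ x₁ := by linarith [hx₁.1]
  have hhalf : (0 : ℝ) ≤ 1 / 2 := by norm_num
  -- the equilibrium belonging to the rate `r`
  have hex : ∀ r, ∃ x, r ∈ Ioo (R (1 / 2)) (R x₁) → x ∈ Ioc (1 / 2) x₁ ∧ R x = r := by
    intro r
    by_cases hr : r ∈ Ioo (R (1 / 2)) (R x₁)
    · obtain ⟨x, hx, rfl⟩ := intermediate_value_Ioo hx₁.1.le hRc.continuousOn hr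
      exact ⟨x, fun _ => ⟨⟨hx.1, hx.2.le⟩, rfl⟩⟩
    · exact ⟨0, fun h => absurd h hr⟩
  choose X hX using hex
  have hex2 : ∀ r, ∃ (γ : ℝ → ℝ × ℝ) (T : ℝ), r ∈ Ioo (R (1 / 2)) (R x₁) →
      IsPeriodicSolution (comovingField N ε r) γ T ∧
      WindsOnceClockwise γ T (X r, -(X r * (X r - 1))) ∧
      HasAsymptoticPhase (comovingField N ε r) γ ∧
      ∀ t, dist (γ t) (X r, -(X r * (X r - 1))) ≤
        2 * √(2 * (2 * X r - 1) * taylorCoeff N 1 1) * max 1 √(ε * taylorCoeff N 1 1) := by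
    intro r
    by_cases hr : r ∈ Ioo (R (1 / 2)) (R x₁)
    · obtain ⟨hx, hxr⟩ := hX r hr
      obtain ⟨γ, T, h⟩ := H (X r) hx
      rw [show ∑ n ∈ Finset.Icc 1 N, X r ^ n = r from hxr] at h
      exact ⟨γ, T, fun _ => h⟩
    · exact ⟨fun _ => 0, 0, fun h => absurd h hr⟩
  choose γ T hγ using hex2
  refine ⟨R x₁ - R (1 / 2), sub_pos.2 (hmono hhalf hx₁0 hx₁.1), γ, T, fun r hr => ?_,
    fun η hη => ?_⟩
  · rw [hR0, add_sub_cancel] at hr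
    obtain ⟨hper, hwind, hphase, -⟩ := hγ r hr
    obtain ⟨-, hxr⟩ := hX r hr
    have hlip := locallyLipschitz_comovingField N ε r
    refine ⟨hphase.isLimitCycle hlip hper, hphase.isAsymptoticallyStableOrbit hlip, ⟨_, ?_, hwind⟩,
      fun t => ?_, hphase.forced_tracking⟩
    · have := comovingField_equilibrium N ε (X r)
      rwa [show ∑ n ∈ Finset.Icc 1 N, X r ^ n = r from hxr] at this
    · exact (hasDerivWithinAt_spiralCurve (s := univ) (hper.1 t).hasDerivWithinAt).hasDerivAt
        univ_mem
  · -- the size of the cycle and the distance of its centre from `(1/2, 1/4)` are small near `1/2`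
    set B : ℝ → ℝ := fun x => 2 * √(2 * (2 * x - 1) * taylorCoeff N 1 1) *
      max 1 √(ε * taylorCoeff N 1 1) + dist (x, -(x * (x - 1))) ((1 / 2 : ℝ), (1 / 4 : ℝ)) with hB
    have hBc : Continuous B := by simp only [hB]; fun_prop
    have hB0 : B (1 / 2) = 0 := by simp only [hB]; norm_num
    obtain ⟨ρ, hρ, hball⟩ := Metric.eventually_nhds_iff.1
      ((hBc.tendsto (1 / 2)).eventually (gt_mem_nhds (by rw [hB0]; exact hη)))
    set x₂ := min x₁ (1 / 2 + ρ / 2) with hx₂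
    have hx₂1 : 1 / 2 < x₂ := lt_min hx₁.1 (by linarith)
    have hx₂0 : (0 : ℝ) ≤ x₂ := by linarith
    have hlt : R (1 / 2) < R x₂ := hmono hhalf hx₂0 hx₂1
    rw [hR0]
    filter_upwards [Ioo_mem_nhdsGT hlt] with r hr t
    have hr' : r ∈ Ioo (R (1 / 2)) (R x₁) :=
      ⟨hr.1, hr.2.trans_le (hmono.monotoneOn hx₂0 hx₁0 (min_le_left _ _))⟩
    obtain ⟨hx, hxr⟩ := hX r hr'
    have hXlt : X r < x₂ := by
      have hX0 : (0 : ℝ) ≤ X r := by linarith [hx.1]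
      rw [← hmono.lt_iff_lt hX0 hx₂0, hxr]
      exact hr.2
    have hbound : B (X r) < η := hball (by
      have := hXlt.le.trans (min_le_right _ _)
      rw [Real.dist_eq, abs_of_pos (by linarith [hx.1])]
      linarith)
    refine lt_of_le_of_lt ?_ hbound
    exact (dist_triangle _ _ _).trans (add_le_add ((hγ r hr').2.2.2 t) le_rfl)
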